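/- **Definitions.** $\log$ is to base $2$. Let $n=n'T\ge 2$, $B\le T$, and $0<\varepsilon<1$. A string $x\in\{0,1\}^n$ is *$B$-distinct* if any two length-$B$ substrings of $x$ at different positions are distinct. Let $x_T=(x_T[1],\dots,x_T[n'])$ be the partition of $x$ into consecutive blocks of length $T$; an interval $(l,r]$ stands for the indices $l+1,\dots,r$. For functions $h=(h[1],\dots,h[n'])$ with $h[t]:\{0,1\}^B\to\{0,1\}^R$, a *matching* of size $k$ between $x_T(l_1,r_1]$ and $x(l_2,r_2]$ under $h$ is a sequence of pairs $(a_1,b_1),\dots,(a_k,b_k)$ with $l_1<a_1<\dots<a_k\le r_1$, $l_2<b_1$, $b_s+T\le b_{s+1}$, $b_k+T-1\le r_2$, such that $h[a_s]$ takes the same value on the $B$-prefixes of $x_T[a_s]$ and of $x[b_s,b_s+T-1]$ for every $s$. $\mathsf{MATCH}_h(x_T(l_1,r_1],x(l_2,r_2])$ is the largest size of a matching between $x_T(l_1,r_1]$ and $x(l_2,\min(r_2+T-1,n)]$. The sequence $h$ is a sequence of *$\varepsilon$-synchronization hash functions* with respect to $x$ if 1. $\mathsf{MATCH}_h(x_T(j,t],x(i,Tj])<\varepsilon\big((t-j)+\frac{Tj-i}{T}\big)$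 whenever $0\le i<Tj$, $j<t\le n'$; 2. $\mathsf{MATCH}_h(x_T(i,j],x(T(j-1)+1,t])<\varepsilon\big((j-i)+\frac{t-T(j-1)-1}{T}\big)$ whenever $0\le i<j\le n'$, $T(j-1)+1<t\le n$. A function $g:\{0,1\}^d\to\{0,1\}^N$ is an *$\eta$-almost $\kappa$-wise independence generator* (in max norm) if, on a uniform seed, any $\kappa$ distinct output bits take any prescribed value in $\{0,1\}^\kappa$ with probability within $\eta$ of $2^{-\kappa}$. A *generator family* with constant $C$ gives such a $g$ for all $N\ge2$, $\kappa\ge1$, $0<\eta\le1$, with seed length $d\le C\,(1+\log\frac{\kappa\log N}{\eta})$. **Construction.** Fix a generator family and positive constants $a,b,c,e,e'$. Put $R=\lceil a(\log^{0.5}n+\log T)\rceil$, $\ell=\lceil c\log n/R\rceil$, $m=2\lceil T\log^{0.6}n\rceil$, $R_\theta=\lceil b\log m\rceil$. * *$\phi$:* View the output of the $n^{-e}$-almost $2R\ell$-wise independence generator with $n'2^BR$ output bits, on a seed $u$, as functions $\phi[1],\dots,\phi[n']:\{0,1\}^B\to\{0,1\}^R$. Search for a seed $u$ such that, for all $0\le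 i_1<i_2\le n'$ and $0\le j_1<j_2\le n$ with $(i_2-i_1)+\frac{j_2-j_1}{T}\le\frac{3\ell}{\varepsilon}$ for which $x(i_1T,i_2T]$ and $x(j_1,j_2]$ overlap in fewer than $T$ bits, there is no matching of size $\ell$ between $x_T(i_1,i_2]$ and $x(j_1,j_2]$ under $\phi$. * *$\theta$:* Let $S_t$ be the set of substrings $x[u,u+B)$ with $1\le u\le n-B+1$ and $|T(t-1)+1-u|<T\log^{0.6}n$. View the output of the $m^{-e'}$-almost $2R_\theta$-wise independence generator with $2^BR_\theta$ output bits as a function $\{0,1\}^B\to\{0,1\}^{R_\theta}$, and let $\theta[t]$ be the function given by the lexicographically smallest seed for which it is injective on $S_t$. * Let $\Phi[t](s)=(\phi[t](s),\theta[t](s))\in\{0,1\}^{R+R_\theta}$. **Theorem.** Generator families exist (the powering construction over finite fields of characteristic $2$ is one). There are absolute constants $b,e'>0$ and, for every $0<\varepsilon<1$, constants $a,c,e>0$ depending only on $\varepsilon$, such that for every generator family and all $n',T,B$ with $B\le T$ and $n=n'T\ge2$, and every $B$-distinct $x\in\{0,1\}^n$: * the seed of $\phi$ has $O(\log n)$ bits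 and that of each $\theta[t]$ has $O(\log B+\log m)$ bits, where the implied constants depend only on the family's constant $C$ and, for $\phi$, on $\varepsilon$; * the search for $\phi$ and the searches for all $\theta[t]$ succeed; * for any seed $u$ found by the search, $\mathsf{MATCH}_\phi(x_T(i_1,i_2],x(j_1,j_2])<\varepsilon\big((i_2-i_1)+\frac{j_2-j_1}{T}\big)$ for all $0\le i_1<i_2\le n'$, $0\le j_1<j_2\le n$ such that $(i_2-i_1)+\frac{j_2-j_1}{T}\ge\log^{0.6}n$ and $x(i_1T,i_2T]$ and $x(j_1,\min(j_2+T-1,n)]$ overlap in fewer than $T$ bits; each $\theta[t]$ is injective on $S_t$; and $\Phi=(\Phi[1],\dots,\Phi[n'])$ is a sequence of $\varepsilon$-synchronization hash functions with respect to $x$. -/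

import Mathlib

namespace SyncHash

noncomputable section

/-! Strings are functions `Fin n → Bool`.  Positions and blocks are counted from `0`, so the
one-based interval written `(l, r]` is the set of indices `p` with `l ≤ p < r`; the end points
`l`, `r` are the same numbers in both conventions. -/

/-- The length-`L` substring of `x` that starts at position `u`.
It is used only when `u + L ≤ n`; the value `false` outside `x` is never read then. -/
def sub {n : ℕ} (x : Fin n → Bool) (L u : ℕ) : Fin L → Bool :=
  fun i => if h : u + i.val < n then x ⟨u + i.val, h⟩ else false

/-- Every two substrings of length `B` at different positions of `x` are distinct. -/
def BDistinct {n : ℕ} (B : ℕ) (x : Fin n → Bool) : Prop :=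
  ∀ u v : ℕ, u + B ≤ n → v + B ≤ n → sub x B u = sub x B v → u = v

/-! ### Matchings and synchronization hash functions -/

/-- `w` is a monotone matching, under the hash functions `h`, between the blocks
`x_T(l₁, r₁]` of `x` and the substring `y(l₂, r₂]`.  A pair `(a, b)` matches block `a` of `x`
(its first bit is at position `a * T`) with the length-`T` substring of `y` starting at `b`;
the hash functions read only the `B`-prefixes. -/
def IsMatching {n' T B R m : ℕ} (h : Fin n' → (Fin B → Bool) → (Fin R → Bool))
    (x : Fin (n' * T) → Bool) (y : Fin m → Bool) (l₁ r₁ l₂ r₂ : ℕ)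
    (w : List (Fin n' × ℕ)) : Prop :=
  w.Pairwise (fun p q => p.1 < q.1 ∧ p.2 + T ≤ q.2) ∧
  ∀ p ∈ w, (l₁ ≤ p.1.val ∧ p.1.val < r₁) ∧ (l₂ ≤ p.2 ∧ p.2 + T ≤ r₂) ∧
    h p.1 (sub x B (p.1.val * T)) = h p.1 (sub y B p.2)

/-- A matching has at most `n'` pairs, so the supremum in `MATCH` is a maximum. -/
theorem IsMatching.length_le {n' T B R m : ℕ} {h : Fin n' → (Fin B → Bool) → (Fin R → Bool)}
    {x : Fin (n' * T) → Bool} {y : Fin m → Bool} {l₁ r₁ l₂ r₂ : ℕ}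
    {w : List (Fin n' × ℕ)} (hw : IsMatching h x y l₁ r₁ l₂ r₂ w) : w.length ≤ n' := by
  have h1 : (w.map Prod.fst).Nodup := by
    rw [List.Nodup, List.pairwise_map]
    exact hw.1.imp (fun hpq => ne_of_lt hpq.1)
  simpa using h1.length_le_card

/-- The size of the maximum matching between `x_T(l₁, r₁]` and `y(l₂, min(r₂ + T, m + 1))`
(the right end point being excluded). -/
def MATCH {n' T B R m : ℕ} (h : Fin n' → (Fin B → Bool) → (Fin R → Bool))
    (x : Fin (n' * T) → Bool) (y : Fin m → Bool) (l₁ r₁ l₂ r₂ : ℕ) : ℕ :=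
  sSup {k : ℕ | ∃ w, IsMatching h x y l₁ r₁ l₂ (min (r₂ + T - 1) m) w ∧ w.length = k}

/-- `Φ` is a sequence of `ε`-synchronization hash functions with respect to `x`. -/
def IsSyncHash {n' T B R : ℕ} (ε : ℝ) (x : Fin (n' * T) → Bool)
    (Φ : Fin n' → (Fin B → Bool) → (Fin R → Bool)) : Prop :=
  (∀ i j t : ℕ, i < T * j → j < t → t ≤ n' →
    (MATCH Φ x x j t i (T * j) : ℝ) <
      ε * (((t : ℝ) - j) + ((T : ℝ) * j - i) / T)) ∧
  (∀ i j t : ℕ, i < j → j ≤ n' → T * (j - 1) + 1 < t → t ≤ n' * T →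
    (MATCH Φ x x i j (T * (j - 1) + 1) t : ℝ) <
      ε * (((j : ℝ) - i) + ((t : ℝ) - (T : ℝ) * ((j : ℝ) - 1) - 1) / T))

/-! ### Almost independent bit generators -/

/-- A function `{0,1}^seedLen → {0,1}^N`. -/
structure BitGenerator (N : ℕ) where
  /-- the seed length -/
  seedLen : ℕ
  /-- the output on a seed -/
  out : (Fin seedLen → Bool) → Fin N → Bool

/-- `g` is an `η`-almost `κ`-wise independence generator in max norm: on a uniform seed, any `κ`
output bits (at different places) take any given value with probability `2^{-κ} ± η`. -/
def IsAlmostIndep {N : ℕ} (g : BitGenerator N) (κ : ℕ) (η : ℝ) : Prop :=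
  ∀ (idx : Fin κ ↪ Fin N) (z : Fin κ → Bool),
    |((Finset.univ.filter
        (fun u : Fin g.seedLen → Bool => ∀ k, g.out u (idx k) = z k)).card : ℝ)
        / 2 ^ g.seedLen - (1 / 2) ^ κ| ≤ η

/-- `G` provides, for all parameters, an `η`-almost `κ`-wise independence generator with `N`
output bits and seed length `O(log (κ log N / η))`, with implied constant `C`. -/
def IsGeneratorFamily (G : (N : ℕ) → ℕ → ℝ → BitGenerator N) (C : ℝ) : Prop :=
  ∀ (N κ : ℕ) (η : ℝ), 2 ≤ N → 1 ≤ κ → 0 < η → η ≤ 1 →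
    IsAlmostIndep (G N κ η) κ η ∧
    ((G N κ η).seedLen : ℝ) ≤ C * (1 + Real.logb 2 (κ * Real.logb 2 N / η))

/-- A basis of the field with `2^(k+1)` elements over the field with two elements. -/
def fieldBasis (k : ℕ) : Module.Basis (Fin (k + 1)) (ZMod 2) (GaloisField 2 (k + 1)) :=
  Module.finBasisOfFinrankEq (ZMod 2) (GaloisField 2 (k + 1))
    (GaloisField.finrank 2 (Nat.succ_ne_zero k))

/-- The element of the field with `2^(k+1)` elements that has the given coordinates. -/
def fieldOfBits (k : ℕ) (v : Fin (k + 1) → Bool) : GaloisField 2 (k + 1) :=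
  ∑ b, if v b then fieldBasis k b else 0

open Classical in
/-- The powering construction of an almost `κ`-wise independent sample space.
Let `E` and `F` be the fields with `2^(w+1) ≥ N` and `2^(k+1) ≥ κ (w+1) / η` elements, and let
`α_i ∈ E` have the binary digits of `i` as coordinates.  The concatenated coordinates of
`1, α_i, …, α_i^(κ-1)` are the coefficients of a polynomial `P_i` over the field with two
elements (any `κ` of the `P_i` are linearly independent).  The seed is a pair `(s, r)` in
`F × F`, and the `i`-th output bit is the first coordinate of `r * P_i(s)`. -/
def powerGenerator (N κ : ℕ) (η : ℝ) : BitGenerator N :=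
  let w := Nat.clog 2 N
  let k := Nat.clog 2 ⌈(κ * (w + 1) : ℝ) / η⌉₊
  { seedLen := (k + 1) + (k + 1)
    out := fun u i =>
      let s := fieldOfBits k (fun b => u (Fin.castAdd (k + 1) b))
      let r := fieldOfBits k (fun b => u (Fin.natAdd (k + 1) b))
      let α := fieldOfBits w (fun b => i.val.testBit b.val)
      let P : GaloisField 2 (k + 1) := ∑ e : Fin κ, ∑ b : Fin (w + 1),
        if (fieldBasis w).repr (α ^ e.val) b = 1 then s ^ (e.val * (w + 1) + b.val) else 0
      decide ((fieldBasis k).repr (r * P) 0 = 1) }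

/-! ### The two hash families -/

/-- The numbering of `{0,1}^B`. -/
def wordEquiv (B : ℕ) : (Fin B → Bool) ≃ Fin (2 ^ B) :=
  (Equiv.arrowCongr (Equiv.refl (Fin B)) finTwoEquiv.symm).trans finFunctionFinEquiv

/-- The output of `g` on seed `u`, viewed as an element of `({0,1}^R)^([n'] × {0,1}^B)`. -/
def phiOf {n' B R : ℕ} (g : BitGenerator (n' * 2 ^ B * R)) (u : Fin g.seedLen → Bool) :
    Fin n' → (Fin B → Bool) → (Fin R → Bool) :=
  fun t s r => g.out u (finProdFinEquiv (finProdFinEquiv (t, wordEquiv B s), r))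

/-- The output of `g` on seed `u`, viewed as an element of `({0,1}^R)^({0,1}^B)`. -/
def thetaOf {B R : ℕ} (g : BitGenerator (2 ^ B * R)) (u : Fin g.seedLen → Bool) :
    (Fin B → Bool) → (Fin R → Bool) :=
  fun s r => g.out u (finProdFinEquiv (wordEquiv B s, r))

/-- The number of common bits of `x(l, r]` and `x(l', r']`. -/
def overlap (l r l' r' : ℕ) : ℕ := (Finset.Ico l r ∩ Finset.Ico l' r').card

/-- The test that the exhaustive search performs on the candidate sequence `φ`: no two short
intervals that overlap in fewer than `T` bits have a matching of size `ℓ` under `φ`. -/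
def PassesSearch {n' T B R : ℕ} (ε : ℝ) (ℓ : ℕ) (x : Fin (n' * T) → Bool)
    (φ : Fin n' → (Fin B → Bool) → (Fin R → Bool)) : Prop :=
  ∀ i₁ i₂ j₁ j₂ : ℕ, i₁ < i₂ → i₂ ≤ n' → j₁ < j₂ → j₂ ≤ n' * T →
    ((i₂ : ℝ) - i₁) + ((j₂ : ℝ) - j₁) / T ≤ 3 * ℓ / ε →
    overlap (i₁ * T) (i₂ * T) j₁ j₂ < T →
    ¬ ∃ w, IsMatching φ x x i₁ i₂ j₁ j₂ w ∧ w.length = ℓ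

/-- The synchronization inequality on long intervals. -/
def LongIntervalProperty {n' T B R : ℕ} (ε : ℝ) (x : Fin (n' * T) → Bool)
    (φ : Fin n' → (Fin B → Bool) → (Fin R → Bool)) : Prop :=
  ∀ i₁ i₂ j₁ j₂ : ℕ, i₁ < i₂ → i₂ ≤ n' → j₁ < j₂ → j₂ ≤ n' * T →
    Real.logb 2 ((n' * T : ℕ) : ℝ) ^ (0.6 : ℝ) ≤ ((i₂ : ℝ) - i₁) + ((j₂ : ℝ) - j₁) / T →
    overlap (i₁ * T) (i₂ * T) j₁ (min (j₂ + T - 1) (n' * T)) < T →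
    (MATCH φ x x i₁ i₂ j₁ j₂ : ℝ) < ε * (((i₂ : ℝ) - i₁) + ((j₂ : ℝ) - j₁) / T)

/-- `S_t`: the length-`B` substrings of `x` starting at distance less than `T log^0.6 n` from the
first bit of block `t`. -/
def nearby {n' T : ℕ} (B : ℕ) (x : Fin (n' * T) → Bool) (t : Fin n') : Set (Fin B → Bool) :=
  {s | ∃ u : ℕ, u + B ≤ n' * T ∧
    |(T : ℝ) * (t.val : ℝ) - (u : ℝ)| < T * Real.logb 2 ((n' * T : ℕ) : ℝ) ^ (0.6 : ℝ) ∧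
    s = sub x B u}

/-! ### Parameters of the construction, up to the constants -/

/-- Output length `R = Θ(log^0.5 n + log T)` of `φ[t]`. -/
def phiLen (a : ℝ) (n T : ℕ) : ℕ :=
  ⌈a * (Real.logb 2 n ^ (0.5 : ℝ) + Real.logb 2 T)⌉₊

/-- Matching size `ℓ = Θ(log n / R)` used in the search. -/
def searchSize (a c : ℝ) (n T : ℕ) : ℕ := ⌈c * Real.logb 2 n / phiLen a n T⌉₊

/-- A common bound `m = O(T log^0.6 n)` on the number of elements of the sets `S_t`. -/
def nearbyBound (n T : ℕ) : ℕ := 2 * ⌈(T : ℝ) * Real.logb 2 n ^ (0.6 : ℝ)⌉₊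

/-- Output length `O(log m)` of `θ[t]`. -/
def thetaLen (b : ℝ) (n T : ℕ) : ℕ := ⌈b * Real.logb 2 (nearbyBound n T)⌉₊

/-- The generator behind `φ`: it is `η`-almost `κ`-wise independent, where `η = n^{-e}` and
`κ = 2 R ℓ` is the number of bits in `ℓ` pairs of hash values. -/
def phiGen (G : (N : ℕ) → ℕ → ℝ → BitGenerator N) (a c e : ℝ) (n' T B : ℕ) :
    BitGenerator (n' * 2 ^ B * phiLen a (n' * T) T) :=
  G _ (2 * phiLen a (n' * T) T * searchSize a c (n' * T) T) (((n' * T : ℕ) : ℝ) ^ (-e))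

/-- The generator behind `θ[t]`: it is `m^{-e}`-almost `2 R_θ`-wise independent. -/
def thetaGen (G : (N : ℕ) → ℕ → ℝ → BitGenerator N) (b e : ℝ) (n' T B : ℕ) :
    BitGenerator (2 ^ B * thetaLen b (n' * T) T) :=
  G _ (2 * thetaLen b (n' * T) T) ((nearbyBound (n' * T) T : ℝ) ^ (-e))

/-- `v` describes the lexicographically smallest seed for which `θ` is injective on `S`. -/
def IsLeastInjective {B R : ℕ} (g : BitGenerator (2 ^ B * R)) (S : Set (Fin B → Bool))
    (v : Fin g.seedLen → Bool) : Prop :=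
  IsLeast {s : Lex (Fin g.seedLen → Bool) | Set.InjOn (thetaOf g (ofLex s)) S} (toLex v)

/-- `Φ[t] = (φ[t], θ[t])`, with values in `{0,1}^(R + R')`. -/
def combine {n' B R R' : ℕ} (φ : Fin n' → (Fin B → Bool) → (Fin R → Bool))
    (θ : Fin n' → (Fin B → Bool) → (Fin R' → Bool)) :
    Fin n' → (Fin B → Bool) → (Fin (R + R') → Bool) :=
  fun t s => Fin.append (φ t s) (θ t s)

end

end SyncHash

/-!
The existence of both hash families is a probabilistic argument, and the synchronization property
is then deterministic.

*Synchronization.* Under the hypotheses of `IsSyncHash` the two intervals overlap in fewer than `T`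
bits. If they are short (total length below `log^0.6 n`), every position involved is near every
block involved, so the injectivity of `θ` on nearby substrings together with the `B`-distinctness of
`x` forces a matched pair to be a block matched with itself, which the position of the two
intervals excludes: the matching is empty. If they are long, the inequality already holds for `φ`
(`PassesSearch.longIntervalProperty`): a matching with at least `ε L` pairs on intervals of total
length `L` is cut into consecutive pieces of `ℓ` pairs, and by averaging one piece lies on intervals
of total length at most `3 ℓ / ε` (`IsMatching.exists_short_piece`); the search has excluded such a
piece. Cutting works because `ℓ` is small compared to `ε log^0.6 n` unless `ℓ = 1`.

*Success of the searches.* A matching of size `ℓ` between intervals that overlap in fewer than `T`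
bits requires `ℓ` equalities of hash values at `2 ℓ` different pairs (block, word), hence `R ℓ`
equalities between `2 R ℓ` different output bits of the generator. On a random seed this has
probability at most `2^{-Rℓ} + 2^{Rℓ} η` (`IsAlmostIndep.card_collision_le`). Short intervals carry
at most `(81 T / ε²)^ℓ ≤ 2^{Rℓ/2}` candidates, there are at most `n^8` pairs of intervals, and
`R ℓ ≥ 20 log n`, so the union bound succeeds (`phi_union_bound`). The search for `θ[t]` is the
same with single collisions between the at most `m` words of `S_t` (`theta_union_bound`).

*The powering construction.* A parity of the output bits in a nonempty set `A` is a nontrivial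
linear functional of `r * Q(s)`, where `Q` is the sum of the polynomials `P_i`, `i ∈ A`. By the
Vandermonde determinant `Q` is not zero (`sum_powerPoly_ne_zero`), so summing over `r` leaves only
the few roots `s` of `Q`, and the parity has small bias (`abs_sum_char_mul_eval_le`). Small bias of
all parities gives almost independence by Fourier inversion on the cube
(`abs_prob_sub_le_of_bias_le`).
-/

namespace SyncHash


/-! ### The powering construction -/

/-- The nontrivial character `c ↦ (-1) ^ c` of `ZMod 2`, with real values. -/
noncomputable def signChar : AddChar (ZMod 2) ℝ := AddChar.zmodChar 2 (ζ := -1) (by norm_num)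

theorem signChar_one : signChar 1 = -1 := by
  simp [signChar, AddChar.zmodChar_apply, ZMod.val_one]

theorem zmod_two_cases (c : ZMod 2) : c = 0 ∨ c = 1 := by
  revert c; decide

theorem abs_signChar (c : ZMod 2) : |signChar c| = 1 := by
  rcases zmod_two_cases c with rfl | rfl <;> simp [signChar_one]

theorem one_add_signChar (c d : ZMod 2) : 1 + signChar (c + d) = if c = d then 2 else 0 := by
  rcases zmod_two_cases c with rfl | rfl <;> rcases zmod_two_cases d with rfl | rfl <;>
    simp [signChar_one, show (1 : ZMod 2) + 1 = 0 from rfl] <;> norm_num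

theorem signChar_sum {ι : Type*} (A : Finset ι) (f : ι → ZMod 2) :
    signChar (∑ i ∈ A, f i) = ∏ i ∈ A, signChar (f i) := by
  classical
  induction A using Finset.induction_on with
  | empty => simp
  | insert a s ha ih => rw [Finset.sum_insert ha, Finset.prod_insert ha, AddChar.map_add_eq_mul, ih]

/-- The XOR lemma: if every nonempty parity of the bits `X i` has bias at most `δ`, then the bits
take any given value with probability `2^{-|ι|} ± δ`.  The indicator of that value is the average
over `A ⊆ ι` of the characters of the parities on `A`. -/
theorem abs_prob_sub_le_of_bias_le {Ω ι : Type*} [Fintype Ω] [Nonempty Ω] [Fintype ι]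
    [DecidableEq ι] (X : ι → Ω → ZMod 2) (z : ι → ZMod 2) (δ : ℝ) (hδ : 0 ≤ δ)
    (h : ∀ A : Finset ι, A.Nonempty →
      |∑ ω, signChar (∑ i ∈ A, X i ω)| ≤ δ * Fintype.card Ω) :
    |((Finset.univ.filter (fun ω => ∀ i, X i ω = z i)).card : ℝ) / Fintype.card Ω
      - (1 / 2) ^ Fintype.card ι| ≤ δ := by
  classical
  have hΩ : (0 : ℝ) < Fintype.card Ω := by exact_mod_cast Fintype.card_pos
  set P : ℝ := 2 ^ Fintype.card ι with hP
  have hPpos : 0 < P := by positivity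
  set c : ℝ := ((Finset.univ.filter (fun ω => ∀ i, X i ω = z i)).card : ℝ) with hc
  have key : P * c = ∑ A : Finset ι,
      signChar (∑ i ∈ A, z i) * ∑ ω, signChar (∑ i ∈ A, X i ω) := by
    calc P * c = ∑ ω, ∏ i, (1 + signChar (X i ω + z i)) := by
          rw [hc, Finset.card_filter]
          push_cast
          rw [Finset.mul_sum]
          refine Finset.sum_congr rfl fun ω _ => ?_
          simp only [one_add_signChar]
          split_ifs with hω
          · simp [hω, hP]
          · push Not at hω
            obtain ⟨i, hi⟩ := hω
            rw [mul_zero]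
            exact (Finset.prod_eq_zero (Finset.mem_univ i) (by simp [hi])).symm
      _ = ∑ ω, ∑ A : Finset ι, signChar (∑ i ∈ A, z i) * signChar (∑ i ∈ A, X i ω) := by
          refine Finset.sum_congr rfl fun ω _ => ?_
          rw [Finset.prod_one_add, Finset.powerset_univ]
          refine Finset.sum_congr rfl fun A _ => ?_
          rw [signChar_sum, signChar_sum, ← Finset.prod_mul_distrib]
          exact Finset.prod_congr rfl fun i _ => by rw [AddChar.map_add_eq_mul, mul_comm]
      _ = _ := by
          rw [Finset.sum_comm]
          exact Finset.sum_congr rfl fun A _ => by rw [Finset.mul_sum]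
  have hsplit : P * c - Fintype.card Ω = ∑ A ∈ Finset.univ.erase (∅ : Finset ι),
      signChar (∑ i ∈ A, z i) * ∑ ω, signChar (∑ i ∈ A, X i ω) := by
    rw [key, ← Finset.add_sum_erase _ _ (Finset.mem_univ (∅ : Finset ι))]
    simp
  have hbound : |P * c - Fintype.card Ω| ≤ P * (δ * Fintype.card Ω) := by
    rw [hsplit]
    refine (Finset.abs_sum_le_sum_abs _ _).trans ?_
    calc ∑ A ∈ Finset.univ.erase (∅ : Finset ι),
          |signChar (∑ i ∈ A, z i) * ∑ ω, signChar (∑ i ∈ A, X i ω)|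
        ≤ ∑ A ∈ Finset.univ.erase (∅ : Finset ι), δ * Fintype.card Ω := by
          refine Finset.sum_le_sum fun A hA => ?_
          rw [abs_mul, abs_signChar, one_mul]
          exact h A (Finset.nonempty_iff_ne_empty.2 (Finset.ne_of_mem_erase hA))
      _ ≤ ∑ A : Finset ι, δ * Fintype.card Ω :=
          Finset.sum_le_sum_of_subset_of_nonneg (Finset.erase_subset _ _)
            fun _ _ _ => by positivity
      _ = P * (δ * Fintype.card Ω) := by simp [hP]
  have e : c / Fintype.card Ω - (1 / 2) ^ Fintype.card ι
      = (P * c - Fintype.card Ω) / (P * Fintype.card Ω) := by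
    rw [one_div, inv_pow, ← hP]
    field_simp
  rw [e, abs_div, abs_of_pos (mul_pos hPpos hΩ), div_le_iff₀ (mul_pos hPpos hΩ)]
  linarith

/-- For a fixed `s` that is not a root of `Q`, the sum over `r` cancels; so only the roots of `Q`
contribute. -/
theorem abs_sum_char_mul_eval_le {F : Type*} [Field F] [Fintype F]
    (ψ : AddChar F ℝ) (hψ : ψ ≠ 1) (Q : Polynomial F) (hQ : Q ≠ 0) (D : ℕ)
    (hD : Q.natDegree ≤ D) :
    |∑ p : F × F, ψ (p.2 * Q.eval p.1)| ≤ D * Fintype.card F := by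
  classical
  have hprim := AddChar.IsPrimitive.of_ne_one hψ
  rw [Fintype.sum_prod_type]
  have h1 : ∀ s : F, ∑ r : F, ψ (r * Q.eval s) = if s ∈ Q.roots.toFinset then
      (Fintype.card F : ℝ) else 0 := by
    intro s
    rw [AddChar.sum_mulShift _ hprim]
    simp [hQ]
  simp only [h1]
  rw [Finset.sum_ite_mem, Finset.univ_inter, Finset.sum_const, nsmul_eq_mul,
    abs_of_nonneg (by positivity)]
  have h2 : Q.roots.toFinset.card ≤ D :=
    (Multiset.toFinset_card_le _).trans ((Polynomial.card_roots' _).trans hD)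
  gcongr

section Polynomials

variable {E F : Type*} [Field E] [Field F] [Algebra (ZMod 2) E] [Algebra (ZMod 2) F]

/-- The polynomial over `F` whose coefficients are the concatenated coordinates, with respect to
`β`, of `1, α, …, α ^ (κ - 1)`. -/
noncomputable def powerPoly (F : Type*) [Field F] [Algebra (ZMod 2) F] (κ d : ℕ)
    (β : Module.Basis (Fin d) (ZMod 2) E) (α : E) : Polynomial F :=
  ∑ e : Fin κ, ∑ b : Fin d,
    Polynomial.C (algebraMap (ZMod 2) F (β.repr (α ^ e.val) b)) *
      Polynomial.X ^ (e.val * d + b.val)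

theorem natDegree_powerPoly_le (κ d : ℕ) (β : Module.Basis (Fin d) (ZMod 2) E) (α : E) :
    (powerPoly F κ d β α).natDegree ≤ κ * d := by
  refine Polynomial.natDegree_sum_le_of_forall_le _ _ fun e _ =>
    Polynomial.natDegree_sum_le_of_forall_le _ _ fun b _ => ?_
  refine (Polynomial.natDegree_C_mul_X_pow_le _ _).trans ?_
  have h1 := e.2
  have h2 := b.2
  calc e.val * d + b.val ≤ (e.val + 1) * d := by rw [add_mul]; omega
    _ ≤ κ * d := Nat.mul_le_mul_right _ h1

theorem coeff_powerPoly (κ d : ℕ) (β : Module.Basis (Fin d) (ZMod 2) E) (α : E)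
    (e : Fin κ) (b : Fin d) : (powerPoly F κ d β α).coeff (e.val * d + b.val)
      = algebraMap (ZMod 2) F (β.repr (α ^ e.val) b) := by
  have hinj : ∀ (e' : Fin κ) (b' : Fin d), e.val * d + b.val = e'.val * d + b'.val →
      e = e' ∧ b = b' := by
    intro e' b' h
    have h1 : (finProdFinEquiv (e, b)) = finProdFinEquiv (e', b') := by
      ext
      simp only [finProdFinEquiv_apply_val]
      linarith
    simpa using finProdFinEquiv.injective h1
  unfold powerPoly
  simp only [Polynomial.finsetSum_coeff, Polynomial.coeff_C_mul, Polynomial.coeff_X_pow]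
  rw [Finset.sum_eq_single e, Finset.sum_eq_single b]
  · simp
  · intro b' _ hb
    rw [if_neg (fun h => hb (hinj _ _ h).2.symm), mul_zero]
  · simp
  · intro e' _ he
    exact Finset.sum_eq_zero fun b' _ => by
      rw [if_neg (fun h => he (hinj _ _ h).1.symm), mul_zero]
  · simp

/-- A nontrivial vanishing sum of at most `κ` of the polynomials would, coordinate by coordinate,
give a nontrivial linear relation between the rows of a Vandermonde matrix. -/
theorem sum_powerPoly_ne_zero (κ d : ℕ) (β : Module.Basis (Fin d) (ZMod 2) E)
    (α : Fin κ → E) (hα : Function.Injective α) (A : Finset (Fin κ)) (hA : A.Nonempty) :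
    ∑ i ∈ A, powerPoly F κ d β (α i) ≠ 0 := by
  classical
  intro h0
  have h1 : ∀ e : Fin κ, ∑ i ∈ A, α i ^ e.val = 0 := by
    intro e
    apply β.repr.injective
    ext b
    have h2 := congrArg (fun p => Polynomial.coeff p (e.val * d + b.val)) h0
    simp only [Polynomial.finsetSum_coeff, coeff_powerPoly, Polynomial.coeff_zero,
      ← map_sum] at h2
    rw [map_eq_zero] at h2
    simpa using h2
  have h3 : (fun i => if i ∈ A then (1 : E) else 0) = 0 := by
    refine Matrix.eq_zero_of_forall_pow_sum_mul_pow_eq_zero hα fun e => ?_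
    simpa using h1 e
  obtain ⟨i, hi⟩ := hA
  have := congrFun h3 i
  simp [hi] at this

end Polynomials

theorem fieldOfBits_eq (k : ℕ) (v : Fin (k + 1) → Bool) :
    fieldOfBits k v = (fieldBasis k).equivFun.symm (fun b => if v b then 1 else 0) := by
  rw [Module.Basis.equivFun_symm_apply]
  unfold fieldOfBits
  refine Finset.sum_congr rfl fun b _ => ?_
  split_ifs <;> simp

theorem fieldOfBits_bijective (k : ℕ) : Function.Bijective (fieldOfBits k) := by
  have hb : Function.Bijective (fun c : Bool => if c then (1 : ZMod 2) else 0) := by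
    constructor
    · intro a b h; revert a b; decide
    · intro c; revert c; decide
  have h : fieldOfBits k = (fieldBasis k).equivFun.symm ∘
      (fun v : Fin (k + 1) → Bool => fun b => if v b then (1 : ZMod 2) else 0) := by
    funext v; exact fieldOfBits_eq k v
  rw [h]
  refine (LinearEquiv.bijective _).comp ?_
  constructor
  · intro v w hvw
    funext b
    exact hb.1 (congrFun hvw b)
  · intro f
    choose g hg using hb.2
    exact ⟨fun b => g (f b), funext fun b => hg (f b)⟩

/-- Seeds of length `2 (k + 1)` are pairs of elements of the field with `2 ^ (k + 1)` elements. -/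
noncomputable def seedEquiv (k : ℕ) :
    (Fin ((k + 1) + (k + 1)) → Bool) ≃ GaloisField 2 (k + 1) × GaloisField 2 (k + 1) :=
  (Fin.appendEquiv (k + 1) (k + 1)).symm.trans
    (Equiv.prodCongr (Equiv.ofBijective _ (fieldOfBits_bijective k))
      (Equiv.ofBijective _ (fieldOfBits_bijective k)))

theorem card_galoisField (k : ℕ) [Fintype (GaloisField 2 (k + 1))] :
    Fintype.card (GaloisField 2 (k + 1)) = 2 ^ (k + 1) := by
  rw [← Nat.card_eq_fintype_card, GaloisField.card 2 _ (Nat.succ_ne_zero k)]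

theorem powerGenerator_out (N κ : ℕ) (η : ℝ)
    (u : Fin (powerGenerator N κ η).seedLen → Bool) (i : Fin N) :
    (powerGenerator N κ η).out u i =
      let k := Nat.clog 2 ⌈(κ * (Nat.clog 2 N + 1) : ℝ) / η⌉₊
      let p := seedEquiv k u
      decide ((fieldBasis k).repr (p.2 * (powerPoly (GaloisField 2 (k + 1)) κ _
        (fieldBasis (Nat.clog 2 N))
        (fieldOfBits (Nat.clog 2 N) (fun b => i.val.testBit b.val))).eval p.1) 0 = 1) := by
  have hcoef : ∀ (k : ℕ) (c : ZMod 2) (t : GaloisField 2 (k + 1)),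
      (if c = 1 then t else 0) = algebraMap (ZMod 2) (GaloisField 2 (k + 1)) c * t := by
    intro k c t
    rcases zmod_two_cases c with rfl | rfl <;> simp
  unfold powerPoly
  simp only [Polynomial.eval_finsetSum, Polynomial.eval_mul, Polynomial.eval_C,
    Polynomial.eval_pow, Polynomial.eval_X, ← hcoef]
  unfold powerGenerator
  simp only
  congr

theorem powerGenerator_isAlmostIndep (N κ : ℕ) (η : ℝ) (hη : 0 < η) :
    IsAlmostIndep (powerGenerator N κ η) κ η := by
  classical
  intro idx z
  set w := Nat.clog 2 N with hw
  set k := Nat.clog 2 ⌈(κ * (w + 1) : ℝ) / η⌉₊ with hk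
  let F := GaloisField 2 (k + 1)
  let _ : Fintype F := Fintype.ofFinite _
  have hF : Fintype.card F = 2 ^ (k + 1) := card_galoisField k
  let α : Fin κ → GaloisField 2 (w + 1) :=
    fun j => fieldOfBits w (fun b => (idx j).val.testBit b.val)
  have hα : Function.Injective α := by
    intro i j hij
    apply idx.injective
    ext
    have h1 := (fieldOfBits_bijective w).1 hij
    have hlt : ∀ i : Fin κ, (idx i).val < 2 ^ (w + 1) := fun i =>
      (idx i).2.trans_le ((Nat.le_pow_clog one_lt_two N).trans
        (Nat.pow_le_pow_right two_pos (Nat.le_succ _)))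
    refine Nat.eq_of_testBit_eq fun b => ?_
    by_cases hb : b < w + 1
    · exact congrFun h1 ⟨b, hb⟩
    · have : ∀ i : Fin κ, (idx i).val.testBit b = false := fun i =>
        Nat.testBit_lt_two_pow ((hlt i).trans_le (Nat.pow_le_pow_right two_pos (by omega)))
      rw [this, this]
  let Lc : F →+ ZMod 2 := ((fieldBasis k).coord 0).toAddMonoidHom
  have hLc : ∀ y, Lc y = (fieldBasis k).repr y 0 := fun y => rfl
  let ψ : AddChar F ℝ := signChar.compAddMonoidHom Lc
  have hψ : ψ ≠ 1 := by
    intro h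
    have h1 : ψ (fieldBasis k 0) = 1 := by rw [h]; rfl
    have h2 : ψ (fieldBasis k 0) = signChar (Lc (fieldBasis k 0)) := rfl
    rw [h2, hLc, Module.Basis.repr_self, Finsupp.single_eq_same, signChar_one] at h1
    norm_num at h1
  let P : Fin κ → Polynomial F := fun j => powerPoly F κ _ (fieldBasis w) (α j)
  have hbias := abs_prob_sub_le_of_bias_le (Ω := F × F)
    (fun (j : Fin κ) p => Lc (p.2 * (P j).eval p.1)) (fun j => if z j then 1 else 0)
    η hη.le ?_
  · rw [Fintype.card_fin] at hbias
    convert hbias using 4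
    · norm_cast
      refine Finset.card_equiv (seedEquiv k) fun u => ?_
      simp only [Finset.mem_filter, Finset.mem_univ, true_and]
      refine forall_congr' fun j => ?_
      rw [powerGenerator_out]
      simp only [hLc]
      generalize hc : (fieldBasis k).repr (((seedEquiv k) u).2 *
        (P j).eval ((seedEquiv k) u).1) 0 = c
      rcases zmod_two_cases c with rfl | rfl <;> cases z j <;> simp
    · rw [Fintype.card_prod, hF, ← pow_add]
      norm_cast
  · intro A hA
    have hQ := abs_sum_char_mul_eval_le ψ hψ (∑ i ∈ A, P i)
      (sum_powerPoly_ne_zero κ _ (fieldBasis w) α hα A hA) (κ * (w + 1))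
      (Polynomial.natDegree_sum_le_of_forall_le _ _ fun i _ => natDegree_powerPoly_le _ _ _ _)
    have e : ∀ p : F × F, signChar (∑ i ∈ A, Lc (p.2 * (P i).eval p.1))
        = ψ (p.2 * (∑ i ∈ A, P i).eval p.1) := by
      intro p
      rw [Polynomial.eval_finsetSum, Finset.mul_sum, ← map_sum]
      rfl
    simp only [e]
    refine hQ.trans ?_
    rw [Fintype.card_prod]
    have h1 : (κ * (w + 1) : ℝ) / η ≤ (Fintype.card F : ℝ) := by
      refine (Nat.le_ceil _).trans ?_
      have h2 : ⌈(κ * (w + 1) : ℝ) / η⌉₊ ≤ 2 ^ (k + 1) :=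
        (Nat.le_pow_clog one_lt_two _).trans (Nat.pow_le_pow_right two_pos (Nat.le_succ _))
      rw [hF]
      exact Nat.cast_le.2 h2
    rw [div_le_iff₀ hη] at h1
    push_cast
    nlinarith [h1, (Nat.cast_nonneg (Fintype.card F) : (0 : ℝ) ≤ Fintype.card F)]

theorem two_pow_clog_lt (x : ℕ) (hx : 1 ≤ x) : 2 ^ Nat.clog 2 x < 2 * x := by
  rcases hx.eq_or_lt with rfl | hx
  · simp
  · have h1 := Nat.pow_pred_clog_lt_self one_lt_two hx
    have h2 : 0 < Nat.clog 2 x := Nat.clog_pos one_lt_two hx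
    obtain ⟨j, hj⟩ := Nat.exists_eq_succ_of_ne_zero h2.ne'
    rw [hj] at h1 ⊢
    simp only [Nat.succ_eq_add_one, Nat.pred_eq_sub_one, Nat.add_sub_cancel] at h1
    rw [Nat.succ_eq_add_one, pow_succ]
    omega

theorem clog_le_one_add_logb (y : ℝ) (x : ℕ) (hx : 1 ≤ x) (hxy : (x : ℝ) ≤ y) :
    (Nat.clog 2 x : ℝ) ≤ 1 + Real.logb 2 y := by
  have hx' : (1 : ℝ) ≤ x := by exact_mod_cast hx
  have h1 : ((2 : ℝ) ^ Nat.clog 2 x) ≤ 2 * y := by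
    have : ((2 : ℝ) ^ Nat.clog 2 x) ≤ 2 * x := by exact_mod_cast (two_pow_clog_lt x hx).le
    linarith
  have h2 := Real.logb_le_logb_of_le one_lt_two (by positivity) h1
  rw [Real.logb_pow, Real.logb_self_eq_one one_lt_two, mul_one,
    Real.logb_mul two_ne_zero (by linarith), Real.logb_self_eq_one one_lt_two] at h2
  exact h2

theorem powerGenerator_seedLen_le (N κ : ℕ) (η : ℝ) (hN : 2 ≤ N) (hκ : 1 ≤ κ) (hη : 0 < η)
    (hη1 : η ≤ 1) :
    ((powerGenerator N κ η).seedLen : ℝ) ≤ 10 * (1 + Real.logb 2 (κ * Real.logb 2 N / η)) := by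
  have hseed : (powerGenerator N κ η).seedLen
      = (Nat.clog 2 ⌈(κ * (Nat.clog 2 N + 1) : ℝ) / η⌉₊ + 1)
        + (Nat.clog 2 ⌈(κ * (Nat.clog 2 N + 1) : ℝ) / η⌉₊ + 1) := rfl
  have hN' : (2 : ℝ) ≤ N := by exact_mod_cast hN
  have hκ' : (1 : ℝ) ≤ κ := by exact_mod_cast hκ
  have hlog : 1 ≤ Real.logb 2 N := by
    rw [Real.le_logb_iff_rpow_le one_lt_two (by linarith)]; simpa using hN'
  have hw : (Nat.clog 2 N : ℝ) ≤ 1 + Real.logb 2 N :=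
    clog_le_one_add_logb _ _ (by omega) le_rfl
  set y : ℝ := κ * Real.logb 2 N / η with hy
  have hy1 : 1 ≤ y := by
    rw [hy, le_div_iff₀ hη]; nlinarith
  set q : ℝ := (κ * (Nat.clog 2 N + 1) : ℝ) / η with hq
  have hqy : q ≤ 3 * y := by
    rw [hq, hy, ← mul_div_assoc]
    refine div_le_div_of_nonneg_right ?_ hη.le
    nlinarith
  have hq0 : 0 < q := by rw [hq]; positivity
  have hceil : (⌈q⌉₊ : ℝ) ≤ 4 * y := by
    have := (Nat.ceil_lt_add_one hq0.le).le
    linarith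
  have hk := clog_le_one_add_logb (4 * y) ⌈q⌉₊ (Nat.ceil_pos.2 hq0) hceil
  have h4 : Real.logb 2 (4 * y) = 2 + Real.logb 2 y := by
    rw [Real.logb_mul (by norm_num) (by linarith), show (4 : ℝ) = 2 ^ 2 by norm_num,
      Real.logb_pow, Real.logb_self_eq_one one_lt_two]
    norm_num
  have hly : 0 ≤ Real.logb 2 y := Real.logb_nonneg one_lt_two hy1
  rw [hseed]
  push_cast
  linarith

theorem powerGenerator_isGeneratorFamily : IsGeneratorFamily powerGenerator 10 :=
  fun N κ η hN hκ hη hη1 =>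
    ⟨powerGenerator_isAlmostIndep N κ η hη, powerGenerator_seedLen_le N κ η hN hκ hη hη1⟩


/-! ### Matchings -/

section Matchings

variable {n' T B R m : ℕ} {h : Fin n' → (Fin B → Bool) → (Fin R → Bool)}
  {x : Fin (n' * T) → Bool} {y : Fin m → Bool} {l₁ r₁ l₂ r₂ : ℕ} {w : List (Fin n' × ℕ)}

theorem exists_isMatching_length_eq_MATCH (h : Fin n' → (Fin B → Bool) → (Fin R → Bool))
    (x : Fin (n' * T) → Bool) (y : Fin m → Bool) (l₁ r₁ l₂ r₂ : ℕ) :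
    ∃ w, IsMatching h x y l₁ r₁ l₂ (min (r₂ + T - 1) m) w ∧
      w.length = MATCH h x y l₁ r₁ l₂ r₂ := by
  have hmem := Nat.sSup_mem
    (s := {k : ℕ | ∃ w, IsMatching h x y l₁ r₁ l₂ (min (r₂ + T - 1) m) w ∧ w.length = k})
    ⟨0, [], ⟨List.Pairwise.nil, by simp⟩, rfl⟩
    ⟨n', by rintro k ⟨w, hw, rfl⟩; exact hw.length_le⟩
  exact hmem

theorem le_MATCH (hw : IsMatching h x y l₁ r₁ l₂ (min (r₂ + T - 1) m) w) :
    w.length ≤ MATCH h x y l₁ r₁ l₂ r₂ :=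
  le_csSup ⟨n', by rintro k ⟨w, hw, rfl⟩; exact hw.length_le⟩ ⟨w, hw, rfl⟩

/-- A matching of at least `(q + 1) ℓ` pairs can be cut into `q + 1` consecutive pieces with `ℓ`
pairs each; one of them lives on intervals of at most the average length. -/
theorem IsMatching.exists_short_piece {ℓ : ℕ} (hℓ : 1 ≤ ℓ) (hT : 1 ≤ T) (M : ℝ) (q : ℕ) :
    ∀ {l₁ l₂ : ℕ} {w : List (Fin n' × ℕ)}, IsMatching h x y l₁ r₁ l₂ r₂ w →
    (q + 1) * ℓ ≤ w.length →
    ((r₁ : ℝ) - l₁) + ((r₂ : ℝ) - l₂) / T ≤ (q + 1) * M →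
    ∃ i₁ i₂ j₁ j₂ w', l₁ ≤ i₁ ∧ i₁ < i₂ ∧ i₂ ≤ r₁ ∧ l₂ ≤ j₁ ∧ j₁ < j₂ ∧ j₂ ≤ r₂ ∧
      ((i₂ : ℝ) - i₁) + ((j₂ : ℝ) - j₁) / T ≤ M ∧
      IsMatching h x y i₁ i₂ j₁ j₂ w' ∧ w'.length = ℓ := by
  -- a nonempty matching lives on nonempty intervals
  have hne : ∀ {l₁ r₁ l₂ r₂ : ℕ} {w : List (Fin n' × ℕ)}, IsMatching h x y l₁ r₁ l₂ r₂ w →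
      w.length = ℓ → l₁ < r₁ ∧ l₂ < r₂ := by
    intro l₁ r₁ l₂ r₂ w hw hlen
    obtain ⟨p, hp⟩ := List.exists_mem_of_length_pos (l := w) (by omega)
    have := hw.2 p hp
    omega
  induction q with
  | zero =>
    intro l₁ l₂ w hw hlen hM
    have hw' : IsMatching h x y l₁ r₁ l₂ r₂ (w.take ℓ) :=
      ⟨hw.1.sublist (List.take_sublist _ _), fun p hp => hw.2 p (List.mem_of_mem_take hp)⟩
    have hl : (w.take ℓ).length = ℓ := by rw [List.length_take]; omega
    obtain ⟨h1, h2⟩ := hne hw' hl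
    exact ⟨l₁, r₁, l₂, r₂, w.take ℓ, le_rfl, h1, le_rfl, le_rfl, h2, le_rfl,
      by simpa using hM, hw', hl⟩
  | succ q ih =>
    intro l₁ l₂ w hw hlen hM
    have hqℓ : ℓ + ℓ ≤ w.length := by nlinarith
    -- the second part of the matching starts at the pair `(a, b)`
    obtain ⟨⟨a, b⟩, tl, htl⟩ : ∃ p tl, w.drop ℓ = p :: tl := by
      have : 0 < (w.drop ℓ).length := by rw [List.length_drop]; omega
      exact List.exists_cons_of_length_pos this
    have hsplit : w = w.take ℓ ++ (a, b) :: tl := by rw [← htl, List.take_append_drop]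
    have hl : (w.take ℓ).length = ℓ := by rw [List.length_take]; omega
    have hpw := hw.1
    rw [hsplit, List.pairwise_append] at hpw
    obtain ⟨hpw1, hpw2, hpw3⟩ := hpw
    have hab := hw.2 (a, b) (by rw [hsplit]; simp)
    have hw1 : IsMatching h x y l₁ a l₂ b (w.take ℓ) := by
      refine ⟨hpw1, fun p hp => ?_⟩
      have h1 := hw.2 p (List.mem_of_mem_take hp)
      have h2 := hpw3 p hp (a, b) (by simp)
      exact ⟨⟨h1.1.1, h2.1⟩, ⟨h1.2.1.1, h2.2⟩, h1.2.2⟩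
    have hw2 : IsMatching h x y a r₁ b r₂ ((a, b) :: tl) := by
      refine ⟨hpw2, fun p hp => ?_⟩
      have h1 := hw.2 p (by rw [hsplit]; exact List.mem_append_right _ hp)
      refine ⟨⟨?_, h1.1.2⟩, ⟨?_, h1.2.1.2⟩, h1.2.2⟩
      · rcases List.mem_cons.1 hp with rfl | hp
        · exact le_rfl
        · exact ((List.pairwise_cons.1 hpw2).1 p hp).1.le
      · rcases List.mem_cons.1 hp with rfl | hp
        · exact le_rfl
        · exact (Nat.le_add_right _ _).trans ((List.pairwise_cons.1 hpw2).1 p hp).2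
    by_cases hshort : (((a : ℕ) : ℝ) - l₁) + ((b : ℝ) - l₂) / T ≤ M
    · obtain ⟨h1, h2⟩ := hne hw1 hl
      exact ⟨l₁, a, l₂, b, w.take ℓ, le_rfl, h1, hab.1.2.le, le_rfl, h2,
        (Nat.le_add_right _ _).trans hab.2.1.2, hshort, hw1, hl⟩
    · have hlen2 : (q + 1) * ℓ ≤ ((a, b) :: tl).length := by
        rw [← htl, List.length_drop]
        have : (q + 1 + 1) * ℓ = (q + 1) * ℓ + ℓ := by ring
        omega
      obtain ⟨i₁, i₂, j₁, j₂, w', h1, h2, h3, h4, h5, h6, h7⟩ := ih hw2 hlen2 (by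
        push_cast at hM
        push Not at hshort
        have e : ((r₂ : ℝ) - l₂) / T = ((r₂ : ℝ) - b) / T + ((b : ℝ) - l₂) / T := by ring
        rw [e] at hM
        linarith)
      exact ⟨i₁, i₂, j₁, j₂, w', hab.1.1.trans h1, h2, h3, hab.2.1.1.trans h4, h5, h6, h7⟩

theorem overlap_mono {l r l' r' i₁ i₂ j₁ j₂ : ℕ} (h1 : l ≤ i₁) (h2 : i₂ ≤ r) (h3 : l' ≤ j₁)
    (h4 : j₂ ≤ r') : overlap i₁ i₂ j₁ j₂ ≤ overlap l r l' r' :=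
  Finset.card_le_card
    (Finset.inter_subset_inter (Finset.Ico_subset_Ico h1 h2) (Finset.Ico_subset_Ico h3 h4))

end Matchings

/-! ### From short intervals to long intervals -/

/-- If no short pair of intervals carries a matching of size `ℓ`, then a long matching on long
intervals is impossible, because one of its pieces of size `ℓ` would lie on a short pair of
intervals.  For `ℓ = 1` a single matched pair is already a piece, on intervals of total
length `2`. -/
theorem PassesSearch.longIntervalProperty {n' T B R ℓ : ℕ} {ε : ℝ} {x : Fin (n' * T) → Bool}
    {φ : Fin n' → (Fin B → Bool) → (Fin R → Bool)} (hε : 0 < ε) (hε1 : ε < 1)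
    (hT : 1 ≤ T) (hℓ : 1 ≤ ℓ)
    (hlong : ℓ = 1 ∨ 2 * ℓ / ε ≤ Real.logb 2 ((n' * T : ℕ) : ℝ) ^ (0.6 : ℝ))
    (hφ : PassesSearch ε ℓ x φ) : LongIntervalProperty ε x φ := by
  intro i₁ i₂ j₁ j₂ hi hi₂ hj hj₂ hL hov
  have hT' : (0 : ℝ) < T := by exact_mod_cast hT
  by_contra hcon
  push Not at hcon
  obtain ⟨w, hw, hwlen⟩ := exists_isMatching_length_eq_MATCH φ x x i₁ i₂ j₁ j₂
  rw [← hwlen] at hcon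
  set L : ℝ := ((i₂ : ℝ) - i₁) + ((j₂ : ℝ) - j₁) / T with hLdef
  have hLpos : 0 < L := by
    have h1 : (i₁ : ℝ) < i₂ := by exact_mod_cast hi
    have h2 : (j₁ : ℝ) < j₂ := by exact_mod_cast hj
    have h3 : 0 < ((j₂ : ℝ) - j₁) / T := div_pos (by linarith) hT'
    linarith
  have hwpos : 1 ≤ w.length := by
    have : (0 : ℝ) < w.length := (mul_pos hε hLpos).trans_le hcon
    exact_mod_cast this
  rcases hlong with rfl | hlong
  · obtain ⟨p, hp⟩ := List.exists_mem_of_length_pos (l := w) hwpos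
    obtain ⟨⟨h1, h2⟩, ⟨h3, h4⟩, h5⟩ := hw.2 p hp
    refine hφ p.1 (p.1 + 1) p.2 (p.2 + T) (Nat.lt_succ_self _) p.1.2 (by omega)
      (h4.trans (min_le_right _ _)) ?_ ((overlap_mono ?_ ?_ h3 h4).trans_lt hov)
      ⟨[p], ⟨List.pairwise_singleton _ _, ?_⟩, rfl⟩
    · push_cast
      rw [add_sub_cancel_left, add_sub_cancel_left, div_self hT'.ne', mul_one, le_div_iff₀ hε]
      linarith
    · exact Nat.mul_le_mul_right _ h1
    · exact Nat.mul_le_mul_right _ h2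
    · intro p' hp'
      rw [List.mem_singleton.1 hp']
      exact ⟨⟨le_rfl, Nat.lt_succ_self _⟩, ⟨le_rfl, le_rfl⟩, h5⟩
  · have hℓ' : (1 : ℝ) ≤ ℓ := by exact_mod_cast hℓ
    have hLℓ : 2 * ℓ ≤ ε * L := by
      have := hlong.trans hL
      rw [div_le_iff₀ hε] at this
      linarith
    have hL2 : 2 ≤ L := by nlinarith
    have hwℓ : ℓ ≤ w.length := by
      have : (ℓ : ℝ) ≤ w.length := by linarith
      exact_mod_cast this
    -- `q + 1` is the number of full pieces
    obtain ⟨q, hq⟩ : ∃ q, w.length / ℓ = q + 1 :=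
      Nat.exists_eq_succ_of_ne_zero (Nat.div_pos hwℓ hℓ).ne'
    have hq1 : (q + 1) * ℓ ≤ w.length := by rw [← hq]; exact Nat.div_mul_le_self _ _
    have hq2 : w.length < (q + 1 + 1) * ℓ := by
      have := Nat.lt_mul_div_succ w.length hℓ
      rw [hq] at this
      linarith
    have hq2' : (w.length : ℝ) < (q + 1 + 1) * ℓ := by exact_mod_cast hq2
    have hspan : ((i₂ : ℝ) - i₁) + (((min (j₂ + T - 1) (n' * T) : ℕ) : ℝ) - j₁) / T ≤ L + 1 := by
      have h1 : ((min (j₂ + T - 1) (n' * T) : ℕ) : ℝ) ≤ j₂ + T := by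
        have : min (j₂ + T - 1) (n' * T) ≤ j₂ + T := (min_le_left _ _).trans (by omega)
        exact_mod_cast this
      have h2 : (((min (j₂ + T - 1) (n' * T) : ℕ) : ℝ) - j₁) / T ≤ ((j₂ : ℝ) - j₁) / T + 1 := by
        rw [div_add_one hT'.ne']
        gcongr
        linarith
      linarith
    obtain ⟨a₁, a₂, b₁, b₂, w', h1, h2, h3, h4, h5, h6, h7, h8, h9⟩ :=
      hw.exists_short_piece hℓ hT (3 * ℓ / ε) q hq1 (hspan.trans (by
        have h1 : ε * L < (q + 1 + 1) * ℓ := hcon.trans_lt hq2'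
        rw [mul_div_assoc', le_div_iff₀ hε]
        have h3 : (0 : ℝ) ≤ q := Nat.cast_nonneg q
        have h4 : ε * 2 ≤ ε * L := mul_le_mul_of_nonneg_left hL2 hε.le
        -- `(L + 1) / L ≤ 3 / 2` and `q + 2 ≤ 2 (q + 1)`
        nlinarith [mul_nonneg h3 (by linarith : (0 : ℝ) ≤ ℓ)]))
    exact hφ a₁ a₂ b₁ b₂ h2 (h3.trans hi₂) h5 (h6.trans (min_le_right _ _)) h7
      ((overlap_mono (Nat.mul_le_mul_right _ h1) (Nat.mul_le_mul_right _ h3) h4 h6).trans_lt hov)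
      ⟨w', h8, h9⟩

/-! ### Synchronization -/

theorem combine_eq_iff {n' B R R' : ℕ} (φ : Fin n' → (Fin B → Bool) → (Fin R → Bool))
    (θ : Fin n' → (Fin B → Bool) → (Fin R' → Bool)) (t : Fin n') (s s' : Fin B → Bool) :
    combine φ θ t s = combine φ θ t s' ↔ φ t s = φ t s' ∧ θ t s = θ t s' := by
  unfold combine
  constructor
  · intro h
    constructor
    · funext i
      simpa using congrFun h (Fin.castAdd R' i)
    · funext i
      simpa using congrFun h (Fin.natAdd R i)
  · rintro ⟨h1, h2⟩
    rw [h1, h2]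

/-- The synchronization inequality for `Φ` on a pair of intervals.  On long intervals it holds
for `φ` alone; on short intervals all the substrings involved are near each other, and the
injectivity of `θ` excludes every pair of a matching. -/
theorem MATCH_combine_lt {n' T B R R' : ℕ} {ε : ℝ} {x : Fin (n' * T) → Bool}
    {φ : Fin n' → (Fin B → Bool) → (Fin R → Bool)}
    {θ : Fin n' → (Fin B → Bool) → (Fin R' → Bool)} (hε : 0 < ε)
    (hT : 1 ≤ T) (hBT : B ≤ T) (hx : BDistinct B x) (hφ : LongIntervalProperty ε x φ)
    (hθ : ∀ t, Set.InjOn (θ t) (nearby B x t))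
    {i₁ i₂ j₁ j₂ : ℕ} (hi : i₁ < i₂) (hi₂ : i₂ ≤ n') (hj : j₁ < j₂) (hj₂ : j₂ ≤ n' * T)
    (hov : overlap (i₁ * T) (i₂ * T) j₁ (min (j₂ + T - 1) (n' * T)) < T)
    (hne : ∀ a b : ℕ, i₁ ≤ a → a < i₂ → j₁ ≤ b → b < j₂ → a * T ≠ b ∧
      |(T : ℝ) * a - b| < T * (((i₂ : ℝ) - i₁) + ((j₂ : ℝ) - j₁) / T)) :
    (MATCH (combine φ θ) x x i₁ i₂ j₁ j₂ : ℝ) <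
      ε * (((i₂ : ℝ) - i₁) + ((j₂ : ℝ) - j₁) / T) := by
  have hT' : (0 : ℝ) < T := by exact_mod_cast hT
  obtain ⟨w, hw, hwlen⟩ := exists_isMatching_length_eq_MATCH (combine φ θ) x x i₁ i₂ j₁ j₂
  rw [← hwlen]
  by_cases hL : Real.logb 2 ((n' * T : ℕ) : ℝ) ^ (0.6 : ℝ)
      ≤ ((i₂ : ℝ) - i₁) + ((j₂ : ℝ) - j₁) / T
  · refine lt_of_le_of_lt ?_ (hφ i₁ i₂ j₁ j₂ hi hi₂ hj hj₂ hL hov)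
    have hw' : IsMatching φ x x i₁ i₂ j₁ (min (j₂ + T - 1) (n' * T)) w :=
      ⟨hw.1, fun p hp => ⟨(hw.2 p hp).1, (hw.2 p hp).2.1,
        ((combine_eq_iff φ θ _ _ _).1 (hw.2 p hp).2.2).1⟩⟩
    exact_mod_cast le_MATCH hw'
  · push Not at hL
    have hw0 : w = [] := by
      refine List.eq_nil_iff_forall_not_mem.2 fun p hp => ?_
      obtain ⟨⟨h1, h2⟩, ⟨h3, h4⟩, h5⟩ := hw.2 p hp
      have h4' : p.2 + T ≤ j₂ + T - 1 := h4.trans (min_le_left _ _)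
      have h4'' : p.2 + T ≤ n' * T := h4.trans (min_le_right _ _)
      have haT : p.1.val * T + T ≤ n' * T := by
        rw [← Nat.succ_mul]; exact Nat.mul_le_mul_right _ p.1.2
      obtain ⟨hne1, hne2⟩ := hne p.1 p.2 h1 h2 h3 (by omega)
      have hpos := mul_pos hT' (lt_of_le_of_lt (le_trans (abs_nonneg ((T : ℝ) * p.1.val - p.2))
        hne2.le |> fun h => (nonneg_of_mul_nonneg_right h hT')) hL)
      refine hne1 (hx _ _ (by omega) (by omega) (hθ p.1 ?_ ?_
        ((combine_eq_iff φ θ _ _ _).1 h5).2))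
      · refine ⟨p.1.val * T, by omega, ?_, rfl⟩
        push_cast at hpos ⊢
        rw [mul_comm, sub_self, abs_zero]
        exact hpos
      · exact ⟨p.2, by omega, hne2.trans (mul_lt_mul_of_pos_left hL hT'), rfl⟩
    rw [hw0]
    have h1 : (i₁ : ℝ) < i₂ := by exact_mod_cast hi
    have h2 : (j₁ : ℝ) < j₂ := by exact_mod_cast hj
    have h3 : 0 < ((j₂ : ℝ) - j₁) / T := div_pos (by linarith) hT'
    simp only [List.length_nil, Nat.cast_zero]
    exact mul_pos hε (by linarith)

theorem isSyncHash_combine {n' T B R R' : ℕ} {ε : ℝ} {x : Fin (n' * T) → Bool}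
    {φ : Fin n' → (Fin B → Bool) → (Fin R → Bool)}
    {θ : Fin n' → (Fin B → Bool) → (Fin R' → Bool)} (hε : 0 < ε)
    (hT : 1 ≤ T) (hBT : B ≤ T) (hx : BDistinct B x) (hφ : LongIntervalProperty ε x φ)
    (hθ : ∀ t, Set.InjOn (θ t) (nearby B x t)) : IsSyncHash ε x (combine φ θ) := by
  have hT' : (0 : ℝ) < T := by exact_mod_cast hT
  constructor
  · intro i j t hij hjt htn
    have h := MATCH_combine_lt hε hT hBT hx hφ hθ (i₁ := j) (i₂ := t) (j₁ := i) (j₂ := T * j)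
      hjt htn hij (by rw [mul_comm]; exact Nat.mul_le_mul_right _ (hjt.le.trans htn)) ?_ ?_
    · simpa using h
    · -- the common part is contained in `[jT, jT + T - 1)`
      refine lt_of_le_of_lt (Finset.card_le_card (t := Finset.Ico (T * j) (T * j + T - 1)) ?_) ?_
      · intro p hp
        simp only [Finset.mem_inter, Finset.mem_Ico, lt_min_iff] at hp ⊢
        rw [mul_comm j] at hp
        omega
      · rw [Nat.card_Ico]; omega
    · intro a b h1 h2 h3 h4
      have hja : j * T ≤ a * T := Nat.mul_le_mul_right _ h1
      have hat : a * T + T ≤ t * T := by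
        rw [← Nat.succ_mul]; exact Nat.mul_le_mul_right _ h2
      rw [mul_comm T j] at h4
      refine ⟨by omega, ?_⟩
      rw [mul_add, mul_div_cancel₀ _ hT'.ne']
      have e1 : (a : ℝ) * T + T ≤ t * T := by exact_mod_cast hat
      have e2 : (i : ℝ) ≤ b := by exact_mod_cast h3
      have e3 : (b : ℝ) < j * T := by exact_mod_cast h4
      have e4 : (j : ℝ) * T ≤ a * T := by exact_mod_cast hja
      push_cast
      rw [abs_lt]
      constructor <;> nlinarith
  · intro i j t hij hjn htj htn
    obtain ⟨j, rfl⟩ : ∃ k, j = k + 1 := ⟨j - 1, by omega⟩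
    rw [Nat.add_sub_cancel] at htj ⊢
    have h := MATCH_combine_lt hε hT hBT hx hφ hθ (i₁ := i) (i₂ := j + 1) (j₁ := T * j + 1)
      (j₂ := t) hij hjn htj htn ?_ ?_
    · have e : (t : ℝ) - (T : ℝ) * (((j + 1 : ℕ) : ℝ) - 1) - 1
          = (t : ℝ) - ((T * j + 1 : ℕ) : ℝ) := by push_cast; ring
      rw [e]
      exact h
    · -- the common part is contained in `[jT + 1, jT + T)`
      refine lt_of_le_of_lt (Finset.card_le_card (t := Finset.Ico (T * j + 1) (T * j + T)) ?_) ?_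
      · intro p hp
        simp only [Finset.mem_inter, Finset.mem_Ico, lt_min_iff] at hp ⊢
        rw [Nat.succ_mul, mul_comm j] at hp
        omega
      · rw [Nat.card_Ico]; omega
    · intro a b h1 h2 h3 h4
      have hia : i * T ≤ a * T := Nat.mul_le_mul_right _ h1
      have haj : a * T ≤ j * T := Nat.mul_le_mul_right _ (by omega)
      rw [mul_comm T j] at h3
      refine ⟨by omega, ?_⟩
      rw [mul_add, mul_div_cancel₀ _ hT'.ne']
      have e1 : (a : ℝ) * T ≤ j * T := by exact_mod_cast haj
      have e2 : (j : ℝ) * T + 1 ≤ b := by exact_mod_cast h3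
      have e3 : (b : ℝ) + 1 ≤ t := by exact_mod_cast h4
      have e4 : (i : ℝ) * T ≤ a * T := by exact_mod_cast hia
      push_cast
      rw [abs_lt]
      constructor <;> nlinarith


/-! ### Collisions under an almost independent generator -/

/-- The union bound, for counting. -/
theorem card_filter_exists_le {U I : Type*} [Fintype U] (s : Finset I) (P : I → U → Prop)
    [∀ i, DecidablePred (P i)] [DecidablePred fun u => ∃ i ∈ s, P i u] (γ : ℝ)
    (h : ∀ i ∈ s, ((Finset.univ.filter (P i)).card : ℝ) ≤ γ) :
    ((Finset.univ.filter (fun u => ∃ i ∈ s, P i u)).card : ℝ) ≤ s.card * γ := by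
  classical
  have e : Finset.univ.filter (fun u => ∃ i ∈ s, P i u)
      = s.biUnion (fun i => Finset.univ.filter (P i)) := by
    ext u; simp
  rw [e]
  calc ((s.biUnion (fun i => Finset.univ.filter (P i))).card : ℝ)
      ≤ ((∑ i ∈ s, (Finset.univ.filter (P i)).card : ℕ) : ℝ) := by
        exact_mod_cast Finset.card_biUnion_le
    _ = ∑ i ∈ s, ((Finset.univ.filter (P i)).card : ℝ) := by push_cast; rfl
    _ ≤ ∑ i ∈ s, γ := Finset.sum_le_sum h
    _ = s.card * γ := by rw [Finset.sum_const, nsmul_eq_mul]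

open Classical in
/-- The bits at the places `p i` agree with those at the places `q i` for at most a fraction
`2^{-|ι|} + 2^{|ι|} η` of the seeds: sum over the `2^{|ι|}` common values. -/
theorem IsAlmostIndep.card_collision_le {N κ : ℕ} {η : ℝ} {g : BitGenerator N}
    (hg : IsAlmostIndep g κ η) {ι : Type*} [Fintype ι] (hκ : Fintype.card (ι ⊕ ι) = κ)
    (p q : ι → Fin N) (hpq : Function.Injective (Sum.elim p q)) :
    ((Finset.univ.filter (fun u => ∀ i, g.out u (p i) = g.out u (q i))).card : ℝ)
      ≤ ((1 / 2) ^ Fintype.card ι + 2 ^ Fintype.card ι * η) * 2 ^ g.seedLen := by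
  let E : Fin κ ≃ ι ⊕ ι := (Fintype.equivFinOfCardEq hκ).symm
  have hvalue : ∀ y ∈ (Finset.univ : Finset (ι → Bool)),
      ((Finset.univ.filter (fun u => ∀ i, g.out u (p i) = y i ∧ g.out u (q i) = y i)).card : ℝ)
        ≤ ((1 / 2) ^ κ + η) * 2 ^ g.seedLen := by
    intro y _
    have h := hg ⟨fun k => Sum.elim p q (E k), hpq.comp E.injective⟩
      (fun k => Sum.elim y y (E k))
    have e : (Finset.univ.filter (fun u : Fin g.seedLen → Bool =>
        ∀ i, g.out u (p i) = y i ∧ g.out u (q i) = y i))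
        = Finset.univ.filter (fun u : Fin g.seedLen → Bool =>
          ∀ k : Fin κ, g.out u (Sum.elim p q (E k)) = Sum.elim y y (E k)) := by
      ext u
      simp only [Finset.mem_filter, Finset.mem_univ, true_and]
      rw [E.forall_congr_left]
      simp [Sum.forall, forall_and]
    rw [e]
    have h1 := (abs_le.1 h).2
    rw [sub_le_iff_le_add, div_le_iff₀ (by positivity)] at h1
    rw [add_comm ((1 / 2 : ℝ) ^ κ)]
    refine le_trans (le_of_eq ?_) h1
    congr!
  have hunion := card_filter_exists_le (Finset.univ : Finset (ι → Bool))
    (fun y (u : Fin g.seedLen → Bool) => ∀ i, g.out u (p i) = y i ∧ g.out u (q i) = y i) _ hvalue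
  refine le_trans ?_ (hunion.trans_eq ?_)
  · refine Nat.cast_le.2 (Finset.card_le_card fun u hu => ?_)
    simp only [Finset.mem_filter, Finset.mem_univ, true_and] at hu ⊢
    exact ⟨fun i => g.out u (p i), fun i => ⟨rfl, (hu i).symm⟩⟩
  · have hκ' : κ = Fintype.card ι + Fintype.card ι := by rw [← hκ, Fintype.card_sum]
    have h2 : (2 : ℝ) ^ Fintype.card ι * (1 / 2) ^ Fintype.card ι = 1 := by
      rw [← mul_pow]; norm_num
    rw [Finset.card_univ, Fintype.card_fun, Fintype.card_bool, hκ', pow_add]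
    push_cast
    linear_combination (1 / 2 : ℝ) ^ Fintype.card ι * 2 ^ g.seedLen * h2

/-! ### The search for `θ` -/

open Classical in
theorem card_thetaOf_collision_le {B R : ℕ} {η : ℝ} {g : BitGenerator (2 ^ B * R)}
    (hg : IsAlmostIndep g (2 * R) η) {s s' : Fin B → Bool} (hs : s ≠ s') :
    ((Finset.univ.filter (fun u => thetaOf g u s = thetaOf g u s')).card : ℝ)
      ≤ ((1 / 2) ^ R + 2 ^ R * η) * 2 ^ g.seedLen := by
  have h := hg.card_collision_le (ι := Fin R) (by simp [two_mul])
    (fun r => finProdFinEquiv (wordEquiv B s, r)) (fun r => finProdFinEquiv (wordEquiv B s', r)) ?_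
  · rw [Fintype.card_fin] at h
    convert h using 5 with u
    exact funext_iff
  · rintro (r | r) (r' | r') hr <;> simp_all [hs.symm]

/-- If the pairs of elements of `S` are few, some seed makes `θ` injective on `S`. -/
theorem exists_injOn_thetaOf {B R : ℕ} {η : ℝ} {g : BitGenerator (2 ^ B * R)}
    (hg : IsAlmostIndep g (2 * R) η) (S : Set (Fin B → Bool)) (m : ℕ) (hS : S.ncard ≤ m)
    (hη : 0 ≤ η) (hsmall : (m : ℝ) ^ 2 * ((1 / 2) ^ R + 2 ^ R * η) < 1) :
    ∃ u, Set.InjOn (thetaOf g u) S := by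
  classical
  by_contra hcon
  push Not at hcon
  let I : Finset ((Fin B → Bool) × (Fin B → Bool)) :=
    (S.toFinset ×ˢ S.toFinset).filter (fun z => z.1 ≠ z.2)
  have hI : I.card ≤ m ^ 2 := by
    refine (Finset.card_filter_le _ _).trans ?_
    rw [Finset.card_product, ← sq, ← Set.ncard_eq_toFinset_card']
    exact Nat.pow_le_pow_left hS 2
  have hunion := card_filter_exists_le I
    (fun z (u : Fin g.seedLen → Bool) => thetaOf g u z.1 = thetaOf g u z.2) _
    (fun z hz => card_thetaOf_collision_le hg (Finset.mem_filter.1 hz).2)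
  have hall : Finset.univ.filter (fun u => ∃ z ∈ I, thetaOf g u z.1 = thetaOf g u z.2)
      = Finset.univ := by
    rw [Finset.filter_true_of_mem]
    intro u _
    have h1 := hcon u
    unfold Set.InjOn at h1
    push Not at h1
    obtain ⟨s, hs, s', hs', h2, h3⟩ := h1
    exact ⟨(s, s'), by simp [I, hs, hs', h3], h2⟩
  rw [hall, Finset.card_univ, Fintype.card_fun, Fintype.card_bool, Fintype.card_fin,
    ← mul_assoc] at hunion
  push_cast at hunion
  have h1 : (1 : ℝ) ≤ I.card * ((1 / 2) ^ R + 2 ^ R * η) := by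
    have h2 : (0 : ℝ) < 2 ^ g.seedLen := by positivity
    by_contra h3
    push Not at h3
    nlinarith
  have h2 : (I.card : ℝ) ≤ (m : ℝ) ^ 2 := by exact_mod_cast hI
  have h3 : 0 ≤ (1 / 2 : ℝ) ^ R + 2 ^ R * η := by positivity
  nlinarith [mul_le_mul_of_nonneg_right h2 h3]

theorem exists_isLeastInjective {B R : ℕ} {g : BitGenerator (2 ^ B * R)}
    {S : Set (Fin B → Bool)} (h : ∃ u, Set.InjOn (thetaOf g u) S) :
    ∃ v, IsLeastInjective g S v := by
  obtain ⟨u, hu⟩ := h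
  have hfin : Finite (Lex (Fin g.seedLen → Bool)) :=
    inferInstanceAs (Finite (Fin g.seedLen → Bool))
  obtain ⟨v, hv⟩ := (Set.toFinite
    {s : Lex (Fin g.seedLen → Bool) | Set.InjOn (thetaOf g (ofLex s)) S}).exists_minimal
      ⟨toLex u, hu⟩
  exact ⟨ofLex v, hv.prop, fun s hs => (le_total v s).elim id (fun h => hv.le_of_le hs h)⟩

theorem ncard_nearby_le {n' T : ℕ} (B : ℕ) (x : Fin (n' * T) → Bool) (t : Fin n') :
    (nearby B x t).ncard ≤ nearbyBound (n' * T) T := by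
  set Δ : ℝ := T * Real.logb 2 ((n' * T : ℕ) : ℝ) ^ (0.6 : ℝ) with hΔ
  let J : Finset ℕ := Finset.Ioo (T * t.val) (T * t.val + ⌈Δ⌉₊) ∪
    Finset.Icc (T * t.val + 1 - ⌈Δ⌉₊) (T * t.val)
  have hsub : nearby B x t ⊆ (sub x B) '' (J : Set ℕ) := by
    rintro s ⟨u, hu, hd, rfl⟩
    refine ⟨u, ?_, rfl⟩
    have hd' : |(T : ℝ) * t.val - u| < ⌈Δ⌉₊ := hd.trans_le (Nat.le_ceil _)
    rw [abs_lt] at hd'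
    have h1 : u < T * t.val + ⌈Δ⌉₊ := by
      have : (u : ℝ) < T * t.val + ⌈Δ⌉₊ := by linarith
      exact_mod_cast this
    have h2 : T * t.val < u + ⌈Δ⌉₊ := by
      have : (T : ℝ) * t.val < u + ⌈Δ⌉₊ := by linarith
      exact_mod_cast this
    simp only [J, Finset.coe_union, Set.mem_union, Finset.coe_Ioo, Finset.coe_Icc, Set.mem_Ioo,
      Set.mem_Icc]
    omega
  calc (nearby B x t).ncard ≤ ((sub x B) '' (J : Set ℕ)).ncard :=
        Set.ncard_le_ncard hsub ((Finset.finite_toSet J).image _)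
    _ ≤ (J : Set ℕ).ncard := Set.ncard_image_le (Finset.finite_toSet J)
    _ = J.card := Set.ncard_coe_finset J
    _ ≤ _ := Finset.card_union_le _ _
    _ ≤ nearbyBound (n' * T) T := by
        rw [Nat.card_Ioo, Nat.card_Icc]
        unfold nearbyBound
        rw [← hΔ]
        omega

/-! ### The search for `φ` -/

open Classical in
theorem card_phiOf_collision_le {n' B R ℓ κ : ℕ} {η : ℝ} {g : BitGenerator (n' * 2 ^ B * R)}
    (hg : IsAlmostIndep g κ η) (hκ : κ = 2 * R * ℓ) (α : Fin ℓ → Fin n')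
    (hα : Function.Injective α) (s s' : Fin ℓ → Fin B → Bool) (hs : ∀ k, s k ≠ s' k) :
    ((Finset.univ.filter
      (fun u => ∀ k, phiOf g u (α k) (s k) = phiOf g u (α k) (s' k))).card : ℝ)
      ≤ ((1 / 2) ^ (R * ℓ) + 2 ^ (R * ℓ) * η) * 2 ^ g.seedLen := by
  have h := hg.card_collision_le (ι := Fin ℓ × Fin R) (by simp [hκ]; ring)
    (fun z => finProdFinEquiv (finProdFinEquiv (α z.1, wordEquiv B (s z.1)), z.2))
    (fun z => finProdFinEquiv (finProdFinEquiv (α z.1, wordEquiv B (s' z.1)), z.2)) ?_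
  · rw [Fintype.card_prod, Fintype.card_fin, Fintype.card_fin, mul_comm ℓ R] at h
    convert h using 5 with u
    simp only [funext_iff, Prod.forall]
    rfl
  · rintro (⟨k, r⟩ | ⟨k, r⟩) (⟨k', r'⟩ | ⟨k', r'⟩) hr <;>
      simp only [Sum.elim_inl, Sum.elim_inr, EmbeddingLike.apply_eq_iff_eq, Prod.mk.injEq] at hr
    · obtain ⟨⟨h1, h2⟩, h3⟩ := hr
      rw [hα h1, h3]
    · obtain ⟨⟨h1, h2⟩, h3⟩ := hr
      obtain rfl := hα h1
      exact absurd h2 (hs k)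
    · obtain ⟨⟨h1, h2⟩, h3⟩ := hr
      obtain rfl := hα h1
      exact absurd h2.symm (hs k)
    · obtain ⟨⟨h1, h2⟩, h3⟩ := hr
      rw [hα h1, h3]

open Classical in
/-- The union bound over the matchings of size `ℓ` on a fixed pair of intervals; a matching is
determined by the set of its blocks and the set of its positions. -/
theorem card_exists_isMatching_le {n' T B R ℓ κ : ℕ} {η : ℝ} (hη : 0 ≤ η)
    {g : BitGenerator (n' * 2 ^ B * R)}
    (hg : IsAlmostIndep g κ η) (hκ : κ = 2 * R * ℓ) {x : Fin (n' * T) → Bool} (hT : 1 ≤ T)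
    (hBT : B ≤ T) (hx : BDistinct B x) {i₁ i₂ j₁ j₂ : ℕ} (hj₂ : j₂ ≤ n' * T)
    (hov : overlap (i₁ * T) (i₂ * T) j₁ j₂ < T) :
    ((Finset.univ.filter (fun u => ∃ w, IsMatching (phiOf g u) x x i₁ i₂ j₁ j₂ w ∧
      w.length = ℓ)).card : ℝ)
      ≤ ((i₂ - i₁).choose ℓ * (j₂ - j₁).choose ℓ : ℕ) *
        (((1 / 2) ^ (R * ℓ) + 2 ^ (R * ℓ) * η) * 2 ^ g.seedLen) := by
  let I : Finset (Finset ℕ × Finset ℕ) :=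
    (Finset.Ico i₁ i₂).powersetCard ℓ ×ˢ (Finset.Ico j₁ j₂).powersetCard ℓ
  have hI : I.card = (i₂ - i₁).choose ℓ * (j₂ - j₁).choose ℓ := by
    simp [I, Finset.card_product, Finset.card_powersetCard]
  -- `α` and `β` list the blocks and the positions of a matching in increasing order
  let P : Finset ℕ × Finset ℕ → (Fin g.seedLen → Bool) → Prop := fun z u =>
    ∃ (α : Fin ℓ → Fin n') (β : Fin ℓ → ℕ), StrictMono α ∧ StrictMono β ∧
      Set.range (fun k => (α k).val) = z.1 ∧ Set.range β = z.2 ∧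
      (∀ k, sub x B ((α k).val * T) ≠ sub x B (β k)) ∧
      ∀ k, phiOf g u (α k) (sub x B ((α k).val * T)) = phiOf g u (α k) (sub x B (β k))
  have hP : ∀ z ∈ I, ((Finset.univ.filter (P z)).card : ℝ)
      ≤ ((1 / 2) ^ (R * ℓ) + 2 ^ (R * ℓ) * η) * 2 ^ g.seedLen := by
    intro z _
    by_cases hz : ∃ u, P z u
    · obtain ⟨u, α, β, hα, hβ, hαz, hβz, hne, -⟩ := hz
      refine le_trans ?_ (card_phiOf_collision_le hg hκ α hα.injective
        (fun k => sub x B ((α k).val * T)) (fun k => sub x B (β k)) hne)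
      refine Nat.cast_le.2 (Finset.card_le_card fun u hu => ?_)
      simp only [Finset.mem_filter, Finset.mem_univ, true_and] at hu ⊢
      obtain ⟨α', β', hα', hβ', hαz', hβz', -, hcol⟩ := hu
      have e1 : (fun k => (α k).val) = fun k => (α' k).val :=
        (StrictMono.range_inj (f := fun k => (α k).val) (g := fun k => (α' k).val)
          (fun _ _ h => hα h) (fun _ _ h => hα' h)).1 (hαz.trans hαz'.symm)
      have e2 : α = α' := funext fun k => Fin.ext (congrFun e1 k)
      have e3 : β = β' := (StrictMono.range_inj hβ hβ').1 (hβz.trans hβz'.symm)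
      rw [e2, e3]
      exact hcol
    · have : Finset.univ.filter (P z) = ∅ :=
        Finset.filter_false_of_mem fun u _ hu => hz ⟨u, hu⟩
      rw [this, Finset.card_empty, Nat.cast_zero]
      positivity
  have hunion := card_filter_exists_le I P _ hP
  rw [hI] at hunion
  refine le_trans (Nat.cast_le.2 (Finset.card_le_card fun u hu => ?_)) hunion
  simp only [Finset.mem_filter, Finset.mem_univ, true_and] at hu ⊢
  obtain ⟨w, hw, rfl⟩ := hu
  have hpw : ∀ k k' : Fin w.length, k < k' → w[k].1 < w[k'].1 ∧ w[k].2 + T ≤ w[k'].2 :=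
    fun k k' hk => List.pairwise_iff_getElem.1 hw.1 k k' k.2 k'.2 hk
  have hα : StrictMono fun k : Fin w.length => w[k].1 := fun k k' hk => (hpw k k' hk).1
  have hβ : StrictMono fun k : Fin w.length => w[k].2 := fun k k' hk => by
    have := (hpw k k' hk).2
    change w[k].2 < w[k'].2
    omega
  have hmem : ∀ k : Fin w.length, w[k] ∈ w := fun k => List.getElem_mem _
  refine ⟨(Finset.univ.image fun k : Fin w.length => w[k].1.val,
    Finset.univ.image fun k : Fin w.length => w[k].2), ?_,
    fun k => w[k].1, fun k => w[k].2, hα, hβ,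
    by rw [Finset.coe_image, Finset.coe_univ, Set.image_univ],
    by rw [Finset.coe_image, Finset.coe_univ, Set.image_univ], ?_,
    fun k => (hw.2 _ (hmem k)).2.2⟩
  · simp only [I, Finset.mem_product, Finset.mem_powersetCard]
    refine ⟨⟨?_, ?_⟩, ?_, ?_⟩
    · intro a ha
      obtain ⟨k, -, rfl⟩ := Finset.mem_image.1 ha
      exact Finset.mem_Ico.2 (hw.2 _ (hmem k)).1
    · rw [Finset.card_image_of_injective _
        (fun k k' h => hα.injective (Fin.ext h)), Finset.card_univ, Fintype.card_fin]
    · intro b hb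
      obtain ⟨k, -, rfl⟩ := Finset.mem_image.1 hb
      have := (hw.2 _ (hmem k)).2.1
      exact Finset.mem_Ico.2 ⟨this.1, by omega⟩
    · rw [Finset.card_image_of_injective _ hβ.injective, Finset.card_univ, Fintype.card_fin]
  · -- a block is never matched with itself, because it would be a common part of `T` bits
    intro k heq
    obtain ⟨⟨h1, h2⟩, ⟨h3, h4⟩, -⟩ := hw.2 _ (hmem k)
    have haT : w[k].1.val * T + T ≤ n' * T := by
      rw [← Nat.succ_mul]; exact Nat.mul_le_mul_right _ w[k].1.2
    have hab : w[k].1.val * T = w[k].2 := hx _ _ (by omega) (by omega) heq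
    have h5 : i₁ * T ≤ w[k].1.val * T := Nat.mul_le_mul_right _ h1
    have h6 : w[k].1.val * T + T ≤ i₂ * T := by
      rw [← Nat.succ_mul]; exact Nat.mul_le_mul_right _ h2
    refine absurd hov (not_lt.2 ?_)
    refine le_trans ?_ (Finset.card_le_card (s := Finset.Ico w[k].2 (w[k].2 + T)) ?_)
    · simp
    · intro p hp
      simp only [Finset.mem_inter, Finset.mem_Ico] at hp ⊢
      omega

theorem choose_le_three_mul_pow {N ℓ : ℕ} {D : ℝ} (hD : 0 ≤ D) (h : (N : ℝ) ≤ D * ℓ) :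
    (N.choose ℓ : ℝ) ≤ (3 * D) ^ ℓ := by
  have h1 : (N.choose ℓ : ℝ) ≤ (N : ℝ) ^ ℓ / ℓ.factorial := Nat.choose_le_pow_div ℓ N
  have h2 : (N : ℝ) ^ ℓ ≤ (D * ℓ) ^ ℓ := pow_le_pow_left₀ (Nat.cast_nonneg _) h _
  have h3 := Real.pow_div_factorial_le_exp (ℓ : ℝ) (Nat.cast_nonneg _) ℓ
  have h4 : Real.exp (ℓ : ℝ) ≤ 3 ^ ℓ := by
    rw [← mul_one (ℓ : ℝ), Real.exp_nat_mul]
    exact pow_le_pow_left₀ (Real.exp_pos _).le (by linarith [Real.exp_one_lt_d9]) _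
  calc (N.choose ℓ : ℝ) ≤ (N : ℝ) ^ ℓ / ℓ.factorial := h1
    _ ≤ (D * ℓ) ^ ℓ / ℓ.factorial := by gcongr
    _ = D ^ ℓ * ((ℓ : ℝ) ^ ℓ / ℓ.factorial) := by rw [mul_pow]; ring
    _ ≤ D ^ ℓ * 3 ^ ℓ := by gcongr; exact h3.trans h4
    _ = (3 * D) ^ ℓ := by rw [mul_pow]; ring

/-- On short intervals there are at most `(81 T / ε²) ^ ℓ` candidates for a matching of size `ℓ`;
if the union bound over all pairs of intervals is nontrivial, the search succeeds. -/
theorem exists_passesSearch {n' T B R ℓ κ : ℕ} {ε η : ℝ} (hε : 0 < ε) (hη : 0 ≤ η)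
    {g : BitGenerator (n' * 2 ^ B * R)}
    (hg : IsAlmostIndep g κ η) (hκ : κ = 2 * R * ℓ) {x : Fin (n' * T) → Bool} (hT : 1 ≤ T)
    (hBT : B ≤ T) (hx : BDistinct B x)
    (hsmall : ((n' * T : ℕ) + 1 : ℝ) ^ 4 * ((81 * T / ε ^ 2) ^ ℓ *
      ((1 / 2) ^ (R * ℓ) + 2 ^ (R * ℓ) * η)) < 1) :
    ∃ u, PassesSearch ε ℓ x (phiOf g u) := by
  classical
  by_contra hcon
  push Not at hcon
  have hT' : (0 : ℝ) < T := by exact_mod_cast hT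
  set β : ℝ := (1 / 2) ^ (R * ℓ) + 2 ^ (R * ℓ) * η with hβ
  have hβ0 : 0 ≤ β := by positivity
  let short : ℕ × ℕ × ℕ × ℕ → Prop := fun z => z.1 < z.2.1 ∧ z.2.1 ≤ n' ∧ z.2.2.1 < z.2.2.2 ∧
    z.2.2.2 ≤ n' * T ∧ ((z.2.1 : ℝ) - z.1) + ((z.2.2.2 : ℝ) - z.2.2.1) / T ≤ 3 * ℓ / ε ∧
    overlap (z.1 * T) (z.2.1 * T) z.2.2.1 z.2.2.2 < T
  let r : Finset ℕ := Finset.range (n' * T + 1)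
  let Q : Finset (ℕ × ℕ × ℕ × ℕ) := (r ×ˢ r ×ˢ r ×ˢ r).filter short
  have hQ : Q.card ≤ (n' * T + 1) ^ 4 := by
    refine (Finset.card_filter_le _ _).trans_eq ?_
    simp only [Finset.card_product, r, Finset.card_range]
    ring
  have hunion := card_filter_exists_le Q
    (fun z (u : Fin g.seedLen → Bool) =>
      ∃ w, IsMatching (phiOf g u) x x z.1 z.2.1 z.2.2.1 z.2.2.2 w ∧ w.length = ℓ)
    ((81 * T / ε ^ 2) ^ ℓ * (β * 2 ^ g.seedLen)) ?_
  · have hall : Finset.univ.filter (fun u => ∃ z ∈ Q,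
        ∃ w, IsMatching (phiOf g u) x x z.1 z.2.1 z.2.2.1 z.2.2.2 w ∧ w.length = ℓ)
        = Finset.univ := by
      rw [Finset.filter_true_of_mem]
      intro u _
      have h1 := hcon u
      unfold PassesSearch at h1
      push Not at h1
      obtain ⟨i₁, i₂, j₁, j₂, h2, h3, h4, h5, h6, h7, h8⟩ := h1
      refine ⟨(i₁, i₂, j₁, j₂), ?_, h8⟩
      have h9 : n' ≤ n' * T := Nat.le_mul_of_pos_right _ hT
      simp only [Q, Finset.mem_filter, Finset.mem_product, r, Finset.mem_range]
      exact ⟨⟨by omega, by omega, by omega, by omega⟩, h2, h3, h4, h5, h6, h7⟩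
    rw [hall, Finset.card_univ, Fintype.card_fun, Fintype.card_bool, Fintype.card_fin] at hunion
    push_cast at hunion
    have h1 : (Q.card : ℝ) ≤ (((n' * T : ℕ) : ℝ) + 1) ^ 4 := by exact_mod_cast hQ
    have h2 : (0 : ℝ) < 2 ^ g.seedLen := by positivity
    have h3 : 0 ≤ (81 * T / ε ^ 2) ^ ℓ * β := by positivity
    nlinarith [mul_le_mul_of_nonneg_right h1 h3]
  · intro z hz
    obtain ⟨-, h2, h3, h4, h5, h6, h7⟩ := Finset.mem_filter.1 hz
    refine (card_exists_isMatching_le hη hg hκ hT hBT hx h5 h7).trans ?_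
    refine mul_le_mul_of_nonneg_right ?_ (by positivity)
    have hi : ((z.2.1 - z.1 : ℕ) : ℝ) = (z.2.1 : ℝ) - z.1 := Nat.cast_sub h2.le
    have hj : ((z.2.2.2 - z.2.2.1 : ℕ) : ℝ) = (z.2.2.2 : ℝ) - z.2.2.1 := Nat.cast_sub h4.le
    rw [← hi, ← hj] at h6
    have c1 := choose_le_three_mul_pow (N := z.2.1 - z.1) (ℓ := ℓ) (D := 3 / ε) (by positivity) (by
      have : 0 ≤ ((z.2.2.2 - z.2.2.1 : ℕ) : ℝ) / T := by positivity
      rw [div_mul_eq_mul_div]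
      linarith)
    have c2 := choose_le_three_mul_pow (N := z.2.2.2 - z.2.2.1) (ℓ := ℓ) (D := 3 * T / ε)
      (by positivity) (by
        have h8 : ((z.2.2.2 - z.2.2.1 : ℕ) : ℝ) / T ≤ 3 * ℓ / ε := by
          have : 0 ≤ ((z.2.1 - z.1 : ℕ) : ℝ) := Nat.cast_nonneg _
          linarith
        rw [div_le_iff₀ hT'] at h8
        refine h8.trans_eq ?_
        ring)
    rw [Nat.cast_mul]
    calc (((z.2.1 - z.1).choose ℓ : ℕ) : ℝ) * (((z.2.2.2 - z.2.2.1).choose ℓ : ℕ) : ℝ)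
        ≤ (3 * (3 / ε)) ^ ℓ * (3 * (3 * T / ε)) ^ ℓ := by gcongr
      _ = (81 * T / ε ^ 2) ^ ℓ := by
        rw [← mul_pow]
        congr 1
        field_simp
        norm_num


/-! ### Parameters -/

theorem one_le_logb_two {y : ℝ} (hy : 2 ≤ y) : 1 ≤ Real.logb 2 y := by
  rw [Real.le_logb_iff_rpow_le one_lt_two (by linarith)]
  simpa using hy

theorem logb_two_le_self {y : ℝ} (hy : 0 < y) : Real.logb 2 y ≤ y := by
  rw [Real.logb_le_iff_le_rpow one_lt_two hy]
  -- `log y ≤ y / e ≤ y log 2`; the first inequality is `1 + t ≤ exp t` at `t = log y - 1`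
  have h3 : Real.log y ≤ y * Real.log 2 := by
    have h4 := Real.add_one_le_exp (Real.log y - 1)
    rw [Real.exp_sub, Real.exp_log hy] at h4
    have h5 : y / Real.exp 1 ≤ y * Real.log 2 := by
      rw [div_eq_mul_inv]
      refine mul_le_mul_of_nonneg_left ?_ hy.le
      rw [inv_le_comm₀ (Real.exp_pos 1) (Real.log_pos one_lt_two)]
      have : (Real.log 2)⁻¹ ≤ 2 := by
        rw [inv_le_comm₀ (Real.log_pos one_lt_two) two_pos]
        linarith [Real.log_two_gt_d9]
      linarith [Real.exp_one_gt_d9]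
    linarith
  rw [Real.rpow_def_of_pos two_pos, ← Real.log_le_iff_le_exp hy]
  linarith

theorem IsGeneratorFamily.seedLen_le {G : (N : ℕ) → ℕ → ℝ → BitGenerator N} {C : ℝ}
    (hG : IsGeneratorFamily G C) {N κ : ℕ} {η Y : ℝ} (hN : 2 ≤ N) (hκ : 1 ≤ κ) (hη : 0 < η)
    (hη1 : η ≤ 1) (hY : κ * Real.logb 2 N / η ≤ Y) :
    ((G N κ η).seedLen : ℝ) ≤ |C| * (1 + Real.logb 2 Y) := by
  have hN' : 1 ≤ Real.logb 2 N := one_le_logb_two (by exact_mod_cast hN)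
  have hκ' : (1 : ℝ) ≤ κ := by exact_mod_cast hκ
  have h1 : 1 ≤ κ * Real.logb 2 N / η := by
    rw [le_div_iff₀ hη]; nlinarith
  have h2 := Real.logb_nonneg one_lt_two h1
  have h3 := Real.logb_le_logb_of_le one_lt_two (by linarith) hY
  refine (hG N κ η hN hκ hη hη1).2.trans ?_
  exact mul_le_mul (le_abs_self C) (by linarith) (by linarith) (abs_nonneg C)

theorem BDistinct.one_le {n B : ℕ} {x : Fin n → Bool} (hx : BDistinct B x) (hn : 1 ≤ n) :
    1 ≤ B := by
  by_contra hB
  obtain rfl : B = 0 := by omega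
  have := hx 0 1 (by omega) (by omega) (funext fun i => i.elim0)
  omega

section PhiParameters

variable {a c : ℝ} {n T : ℕ}

theorem le_phiLen (a : ℝ) (n T : ℕ) :
    a * (Real.logb 2 n ^ (0.5 : ℝ) + Real.logb 2 T) ≤ phiLen a n T := Nat.le_ceil _

theorem rpow_half_bounds {y : ℝ} (hy : 1 ≤ y) : 1 ≤ y ^ (0.5 : ℝ) ∧ y ^ (0.5 : ℝ) ≤ y := by
  refine ⟨Real.one_le_rpow hy (by norm_num), ?_⟩
  calc y ^ (0.5 : ℝ) ≤ y ^ (1 : ℝ) := Real.rpow_le_rpow_of_exponent_le hy (by norm_num)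
    _ = y := Real.rpow_one y

theorem phiLen_pos (ha : 0 < a) (hn : 2 ≤ n) (hT : 1 ≤ T) : 1 ≤ phiLen a n T := by
  have h1 : 1 ≤ Real.logb 2 n := one_le_logb_two (by exact_mod_cast hn)
  have h2 : 0 ≤ Real.logb 2 T := Real.logb_nonneg one_lt_two (by exact_mod_cast hT)
  have h3 := (rpow_half_bounds h1).1
  exact Nat.ceil_pos.2 (mul_pos ha (by linarith))

theorem phiLen_le (ha : 0 < a) (hn : 2 ≤ n) (hT : 1 ≤ T) (hTn : T ≤ n) :
    (phiLen a n T : ℝ) ≤ (2 * a + 1) * Real.logb 2 n := by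
  have h1 : 1 ≤ Real.logb 2 n := one_le_logb_two (by exact_mod_cast hn)
  have h2 : 0 ≤ Real.logb 2 T := Real.logb_nonneg one_lt_two (by exact_mod_cast hT)
  have h3 := rpow_half_bounds h1
  have h4 : Real.logb 2 T ≤ Real.logb 2 n :=
    Real.logb_le_logb_of_le one_lt_two (by exact_mod_cast hT) (by exact_mod_cast hTn)
  have h5 := (Nat.ceil_lt_add_one (a := a * (Real.logb 2 n ^ (0.5 : ℝ) + Real.logb 2 T))
    (by nlinarith)).le
  unfold phiLen
  nlinarith

theorem searchSize_pos (ha : 0 < a) (hc : 0 < c) (hn : 2 ≤ n) (hT : 1 ≤ T) :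
    1 ≤ searchSize a c n T := by
  have h1 : 1 ≤ Real.logb 2 n := one_le_logb_two (by exact_mod_cast hn)
  have h2 : (1 : ℝ) ≤ phiLen a n T := by exact_mod_cast phiLen_pos ha hn hT
  exact Nat.ceil_pos.2 (by positivity)

theorem le_phiLen_mul_searchSize (ha : 0 < a) (hn : 2 ≤ n) (hT : 1 ≤ T) :
    c * Real.logb 2 n ≤ phiLen a n T * searchSize a c n T := by
  have h2 : (1 : ℝ) ≤ phiLen a n T := by exact_mod_cast phiLen_pos ha hn hT
  have h3 : c * Real.logb 2 n / phiLen a n T ≤ searchSize a c n T := Nat.le_ceil _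
  rw [div_le_iff₀ (by linarith)] at h3
  linarith

theorem phiLen_mul_searchSize_le (ha : 0 < a) (hc : 0 < c) (hn : 2 ≤ n) (hT : 1 ≤ T)
    (hTn : T ≤ n) :
    (phiLen a n T : ℝ) * searchSize a c n T ≤ (c + 2 * a + 1) * Real.logb 2 n := by
  have h1 : 1 ≤ Real.logb 2 n := one_le_logb_two (by exact_mod_cast hn)
  have h2 : (1 : ℝ) ≤ phiLen a n T := by exact_mod_cast phiLen_pos ha hn hT
  have h3 : (searchSize a c n T : ℝ) ≤ c * Real.logb 2 n / phiLen a n T + 1 :=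
    (Nat.ceil_lt_add_one (by positivity)).le
  have h4 := phiLen_le ha hn hT hTn
  calc (phiLen a n T : ℝ) * searchSize a c n T
      ≤ phiLen a n T * (c * Real.logb 2 n / phiLen a n T + 1) := by gcongr
    _ = c * Real.logb 2 n + phiLen a n T := by field_simp
    _ ≤ _ := by linarith

/-- Either the search tests single pairs, or its matchings are small compared to `log^0.6 n`. -/
theorem searchSize_eq_one_or_le {ε : ℝ} (hε : 0 < ε) (hc : 0 < c) (hac : 4 * c / ε ≤ a)
    (hn : 2 ≤ n) (hT : 1 ≤ T) :
    searchSize a c n T = 1 ∨ 2 * searchSize a c n T / ε ≤ Real.logb 2 n ^ (0.6 : ℝ) := by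
  have ha : 0 < a := lt_of_lt_of_le (by positivity) hac
  have h1 : 1 ≤ Real.logb 2 n := one_le_logb_two (by exact_mod_cast hn)
  have hR : (1 : ℝ) ≤ phiLen a n T := by exact_mod_cast phiLen_pos ha hn hT
  have h2 : 0 ≤ Real.logb 2 T := Real.logb_nonneg one_lt_two (by exact_mod_cast hT)
  set lam := Real.logb 2 n with hlam
  set q : ℝ := c * lam / phiLen a n T with hq
  have hs : searchSize a c n T = ⌈q⌉₊ := rfl
  have hq0 : 0 < q := by rw [hq]; positivity
  rcases le_or_gt q 1 with hq1 | hq1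
  · left
    rw [hs]
    exact le_antisymm (Nat.ceil_le.2 (by simpa using hq1)) (Nat.ceil_pos.2 hq0)
  · right
    have h3 : (searchSize a c n T : ℝ) ≤ 2 * q := by
      rw [hs]
      linarith [(Nat.ceil_lt_add_one hq0.le).le]
    have hhalf : 0 < lam ^ (0.5 : ℝ) := by positivity
    have h4 : q ≤ (ε / 4) * lam ^ (0.5 : ℝ) := by
      rw [hq, div_le_iff₀ (by linarith)]
      have h5 : a * lam ^ (0.5 : ℝ) ≤ phiLen a n T := by
        refine le_trans ?_ (le_phiLen a n T)
        gcongr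
        linarith
      have h6 : lam ^ (0.5 : ℝ) * lam ^ (0.5 : ℝ) = lam := by
        rw [← Real.rpow_add (by linarith)]; norm_num
      rw [div_le_iff₀ hε] at hac
      calc c * lam = c * (lam ^ (0.5 : ℝ) * lam ^ (0.5 : ℝ)) := by rw [h6]
        _ ≤ (a * ε / 4) * (lam ^ (0.5 : ℝ) * lam ^ (0.5 : ℝ)) := by gcongr; linarith
        _ = ε / 4 * lam ^ (0.5 : ℝ) * (a * lam ^ (0.5 : ℝ)) := by ring
        _ ≤ _ := by gcongr
    have h7 : lam ^ (0.5 : ℝ) ≤ lam ^ (0.6 : ℝ) :=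
      Real.rpow_le_rpow_of_exponent_le h1 (by norm_num)
    rw [div_le_iff₀ hε]
    nlinarith

/-- The union bound of the search for `φ`, with `c = 20`.  In powers of `2`, with
`lam = log n`: there are at most `2 ^ (8 lam)` pairs of intervals, at most `2 ^ (R ℓ / 2)` matchings
on each, and `R ℓ` lies between `20 lam` and `(21 + 2 a) lam`. -/
theorem phi_union_bound {ε e : ℝ} (hε : 0 < ε) (ha : 2 ≤ a)
    (haε : 2 * Real.logb 2 (81 / ε ^ 2) ≤ a) (he : e = 10 + 2 * (20 + 2 * a + 1))
    (hn : 2 ≤ n) (hT : 1 ≤ T) (hTn : T ≤ n) :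
    ((n : ℝ) + 1) ^ 4 * ((81 * T / ε ^ 2) ^ searchSize a 20 n T *
      ((1 / 2) ^ (phiLen a n T * searchSize a 20 n T) +
        2 ^ (phiLen a n T * searchSize a 20 n T) * (n : ℝ) ^ (-e))) < 1 := by
  have ha0 : 0 < a := by linarith
  have hn' : (2 : ℝ) ≤ n := by exact_mod_cast hn
  have hT' : (1 : ℝ) ≤ T := by exact_mod_cast hT
  have h1 : 1 ≤ Real.logb 2 n := one_le_logb_two hn'
  have hT0 : 0 ≤ Real.logb 2 T := Real.logb_nonneg one_lt_two hT'
  have hlow := le_phiLen_mul_searchSize (c := 20) ha0 hn hT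
  have hup := phiLen_mul_searchSize_le (c := 20) ha0 (by norm_num) hn hT hTn
  have hR := le_phiLen a n T
  set lam := Real.logb 2 n with hlam
  set R := phiLen a n T
  set ℓ := searchSize a 20 n T
  set S : ℝ := (R : ℝ) * ℓ with hS
  have hn2 : (n : ℝ) = 2 ^ lam := (Real.rpow_logb two_pos (by norm_num) (by linarith)).symm
  have b1 : ((n : ℝ) + 1) ^ 4 ≤ 2 ^ (8 * lam) := by
    calc ((n : ℝ) + 1) ^ 4 ≤ ((n : ℝ) ^ 2) ^ 4 := by gcongr; nlinarith
      _ = (n : ℝ) ^ (8 : ℝ) := by rw [← pow_mul]; norm_cast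
      _ = 2 ^ (8 * lam) := by
        rw [hn2, ← Real.rpow_mul two_pos.le, mul_comm]
  have b2 : (81 * T / ε ^ 2) ^ ℓ ≤ (2 : ℝ) ^ (S / 2) := by
    have h2 : 81 * T / ε ^ 2 ≤ (2 : ℝ) ^ ((R : ℝ) / 2) := by
      rw [← Real.logb_le_iff_le_rpow one_lt_two (by positivity), mul_div_right_comm,
        Real.logb_mul (by positivity) (by positivity)]
      have h3 := (rpow_half_bounds h1).1
      nlinarith
    calc (81 * T / ε ^ 2) ^ ℓ ≤ ((2 : ℝ) ^ ((R : ℝ) / 2)) ^ ℓ :=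
          pow_le_pow_left₀ (by positivity) h2 _
      _ = (2 : ℝ) ^ (S / 2) := by
        rw [← Real.rpow_natCast, ← Real.rpow_mul two_pos.le, hS]
        congr 1
        ring
  have b3 : (2 : ℝ) ^ (R * ℓ) = 2 ^ S := by
    rw [← Real.rpow_natCast, hS]; push_cast; rfl
  have b4 : (1 / 2 : ℝ) ^ (R * ℓ) = 2 ^ (-S) := by
    rw [Real.rpow_neg two_pos.le, ← b3, one_div, inv_pow]
  have b5 : (n : ℝ) ^ (-e) = 2 ^ (-e * lam) := by
    rw [hn2, ← Real.rpow_mul two_pos.le, mul_comm]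
  rw [b3, b4, b5]
  have hquarter : (2 : ℝ) ^ (-2 * lam) ≤ 1 / 4 := by
    calc (2 : ℝ) ^ (-2 * lam) ≤ 2 ^ (-2 : ℝ) :=
          Real.rpow_le_rpow_of_exponent_le one_lt_two.le (by linarith)
      _ = 1 / 4 := by rw [Real.rpow_neg two_pos.le]; norm_num
  calc ((n : ℝ) + 1) ^ 4 * ((81 * T / ε ^ 2) ^ ℓ * (2 ^ (-S) + 2 ^ S * 2 ^ (-e * lam)))
      ≤ 2 ^ (8 * lam) * (2 ^ (S / 2) * (2 ^ (-S) + 2 ^ S * 2 ^ (-e * lam))) := by gcongr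
    _ = 2 ^ (8 * lam + S / 2 + -S) + 2 ^ (8 * lam + S / 2 + S + -e * lam) := by
        simp only [Real.rpow_add two_pos]; ring
    _ ≤ 2 ^ (-2 * lam) + 2 ^ (-2 * lam) := by
        gcongr 2 ^ ?_ + 2 ^ ?_
        · exact one_lt_two.le
        · linarith
        · exact one_lt_two.le
        · rw [he]; nlinarith
    _ < 1 := by linarith

end PhiParameters

section ThetaParameters

theorem two_le_nearbyBound {n T : ℕ} (hn : 2 ≤ n) (hT : 1 ≤ T) : 2 ≤ nearbyBound n T := by
  have h1 : 1 ≤ Real.logb 2 n := one_le_logb_two (by exact_mod_cast hn)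
  have h2 : (1 : ℝ) ≤ T := by exact_mod_cast hT
  have : 1 ≤ ⌈(T : ℝ) * Real.logb 2 n ^ (0.6 : ℝ)⌉₊ := Nat.ceil_pos.2 (by positivity)
  unfold nearbyBound
  omega

/-- The union bound of the search for `θ`: with `b = 3`, a value of `R_θ` bits has between
`m ^ 3` and `2 m ^ 3` possibilities. -/
theorem theta_union_bound {m : ℕ} (hm : 2 ≤ m) :
    (m : ℝ) ^ 2 * ((1 / 2) ^ ⌈3 * Real.logb 2 m⌉₊ +
      2 ^ ⌈3 * Real.logb 2 m⌉₊ * (m : ℝ) ^ (-8 : ℝ)) < 1 := by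
  have hm' : (2 : ℝ) ≤ m := by exact_mod_cast hm
  have h1 : 1 ≤ Real.logb 2 m := one_le_logb_two hm'
  have hm3 : (2 : ℝ) ^ (3 * Real.logb 2 m) = (m : ℝ) ^ 3 := by
    rw [mul_comm, Real.rpow_mul two_pos.le, Real.rpow_logb two_pos (by norm_num) (by linarith)]
    norm_cast
  set R := ⌈3 * Real.logb 2 m⌉₊
  have hlow : (m : ℝ) ^ 3 ≤ 2 ^ R := by
    rw [← hm3, ← Real.rpow_natCast]
    exact Real.rpow_le_rpow_of_exponent_le one_lt_two.le (Nat.le_ceil _)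
  have hup : (2 : ℝ) ^ R ≤ 2 * (m : ℝ) ^ 3 := by
    rw [← hm3, ← Real.rpow_natCast, mul_comm, ← Real.rpow_add_one two_ne_zero]
    exact Real.rpow_le_rpow_of_exponent_le one_lt_two.le
      (Nat.ceil_lt_add_one (by linarith)).le
  have h8 : (m : ℝ) ^ (-8 : ℝ) = 1 / (m : ℝ) ^ 8 := by
    rw [Real.rpow_neg (by linarith), one_div]
    norm_cast
  have h9 : (1 / 2 : ℝ) ^ R ≤ 1 / (m : ℝ) ^ 3 := by
    rw [one_div_pow]
    exact one_div_le_one_div_of_le (by positivity) hlow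
  have hm0 : (m : ℝ) ≠ 0 := by linarith
  calc (m : ℝ) ^ 2 * ((1 / 2) ^ R + 2 ^ R * (m : ℝ) ^ (-8 : ℝ))
      ≤ (m : ℝ) ^ 2 * (1 / (m : ℝ) ^ 3 + 2 * (m : ℝ) ^ 3 * (1 / (m : ℝ) ^ 8)) := by
        rw [h8]; gcongr
    _ = 1 / (m : ℝ) + 2 * (1 / (m : ℝ)) ^ 3 := by field_simp
    _ ≤ 1 / 2 + 2 * (1 / 2) ^ 3 := by gcongr
    _ < 1 := by norm_num

end ThetaParameters

/-! ### The construction -/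

section Construction

variable {G : (N : ℕ) → ℕ → ℝ → BitGenerator N} {C : ℝ} {n' T B : ℕ}

/-- The generator behind `φ` has at least two output bits, as the definition of a generator family
requires. -/
theorem two_le_phi_outputs {R : ℕ} (hn' : 1 ≤ n') (hB : 1 ≤ B) (hR : 1 ≤ R) :
    2 ≤ n' * 2 ^ B * R := by
  have h1 : 2 ≤ 2 ^ B := by
    calc 2 = 2 ^ 1 := rfl
      _ ≤ 2 ^ B := Nat.pow_le_pow_right two_pos hB
  calc 2 = 1 * 2 * 1 := rfl
    _ ≤ n' * 2 ^ B * R := Nat.mul_le_mul (Nat.mul_le_mul hn' h1) hR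

theorem phiGen_isAlmostIndep (hG : IsGeneratorFamily G C) {a c e : ℝ} (ha : 0 < a) (hc : 0 < c)
    (he : 0 < e) (hn' : 1 ≤ n') (hT : 1 ≤ T) (hB : 1 ≤ B) (hn : 2 ≤ n' * T) :
    IsAlmostIndep (phiGen G a c e n' T B)
      (2 * phiLen a (n' * T) T * searchSize a c (n' * T) T) (((n' * T : ℕ) : ℝ) ^ (-e)) := by
  have hR := phiLen_pos ha hn hT
  have hℓ := searchSize_pos ha hc hn hT
  have h1 : (1 : ℝ) ≤ ((n' * T : ℕ) : ℝ) := by exact_mod_cast one_le_two.trans hn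
  exact (hG _ _ _ (two_le_phi_outputs hn' hB hR)
    (Nat.mul_pos (Nat.mul_pos two_pos hR) hℓ) (by positivity)
    (Real.rpow_le_one_of_one_le_of_nonpos h1 (by linarith))).1

theorem phiGen_seedLen_le (hG : IsGeneratorFamily G C) {a c e : ℝ} (ha : 0 < a) (hc : 0 < c)
    (he : 0 < e) (hn' : 1 ≤ n') (hT : 1 ≤ T) (hB : 1 ≤ B) (hBT : B ≤ T) (hn : 2 ≤ n' * T) :
    ((phiGen G a c e n' T B).seedLen : ℝ) ≤
      |C| * (3 + e + Real.logb 2 (2 * (c + 2 * a + 1) * (2 * a + 3))) *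
        Real.logb 2 ((n' * T : ℕ) : ℝ) := by
  have hR := phiLen_pos ha hn hT
  have hℓ := searchSize_pos ha hc hn hT
  have hTn : T ≤ n' * T := Nat.le_mul_of_pos_left _ hn'
  have hn'n : n' ≤ n' * T := Nat.le_mul_of_pos_right _ hT
  have hup := phiLen_mul_searchSize_le ha hc hn hT hTn
  have hRup := phiLen_le ha hn hT hTn
  set N := n' * T with hN
  have hN2 : (2 : ℝ) ≤ N := by exact_mod_cast hn
  have hlam := one_le_logb_two hN2
  have hlamN := logb_two_le_self (y := (N : ℝ)) (by linarith)
  set lam := Real.logb 2 (N : ℝ)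
  set R := phiLen a N T
  set ℓ := searchSize a c N T
  have hR' : (1 : ℝ) ≤ R := by exact_mod_cast hR
  have hout : Real.logb 2 ((n' * 2 ^ B * R : ℕ) : ℝ) ≤ (2 * a + 3) * N := by
    have h1 : (0 : ℝ) < n' := by exact_mod_cast hn'
    push_cast
    rw [Real.logb_mul (by positivity) (by positivity),
      Real.logb_mul (by positivity) (by positivity), Real.logb_pow,
      Real.logb_self_eq_one one_lt_two]
    have h2 : Real.logb 2 n' ≤ n' := logb_two_le_self h1
    have h3 : Real.logb 2 R ≤ R := logb_two_le_self (by linarith)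
    have h4 : (n' : ℝ) ≤ N := by exact_mod_cast hn'n
    have h5 : (B : ℝ) ≤ N := by exact_mod_cast hBT.trans hTn
    nlinarith
  have hK : 1 ≤ 2 * (c + 2 * a + 1) * (2 * a + 3) := by nlinarith [mul_pos ha ha, mul_pos ha hc]
  have hseed := hG.seedLen_le (N := n' * 2 ^ B * R) (κ := 2 * R * ℓ) (η := (N : ℝ) ^ (-e))
    (Y := 2 * (c + 2 * a + 1) * (2 * a + 3) * (N : ℝ) ^ (2 + e))
    (two_le_phi_outputs hn' hB hR) (Nat.mul_pos (Nat.mul_pos two_pos hR) hℓ) (by positivity)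
    (Real.rpow_le_one_of_one_le_of_nonpos (by linarith) (by linarith)) (by
      rw [Real.rpow_neg (by positivity), div_inv_eq_mul, Real.rpow_add (by positivity),
        Real.rpow_two, ← mul_assoc]
      refine mul_le_mul_of_nonneg_right ?_ (by positivity)
      have h1 : ((2 * R * ℓ : ℕ) : ℝ) ≤ 2 * (c + 2 * a + 1) * N := by
        push_cast
        nlinarith
      have h0 : 0 ≤ Real.logb 2 ((n' * 2 ^ B * R : ℕ) : ℝ) := by
        refine zero_le_one.trans (one_le_logb_two ?_)
        exact_mod_cast two_le_phi_outputs hn' hB hR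
      calc ((2 * R * ℓ : ℕ) : ℝ) * Real.logb 2 ((n' * 2 ^ B * R : ℕ) : ℝ)
          ≤ (2 * (c + 2 * a + 1) * N) * ((2 * a + 3) * N) := by gcongr
        _ = _ := by ring)
  refine hseed.trans ?_
  rw [mul_assoc |C|]
  refine mul_le_mul_of_nonneg_left ?_ (abs_nonneg C)
  rw [Real.logb_mul (by linarith) (by positivity), Real.logb_rpow_eq_mul_logb_of_pos (by linarith)]
  have hK0 := Real.logb_nonneg one_lt_two hK
  change 1 + (_ + (2 + e) * lam) ≤ _
  nlinarith

theorem thetaGen_isAlmostIndep (hG : IsGeneratorFamily G C) (hT : 1 ≤ T) (hB : 1 ≤ B)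
    (hn : 2 ≤ n' * T) : IsAlmostIndep (thetaGen G 3 8 n' T B)
      (2 * thetaLen 3 (n' * T) T) ((nearbyBound (n' * T) T : ℝ) ^ (-8 : ℝ)) := by
  have hm : (2 : ℝ) ≤ nearbyBound (n' * T) T := by exact_mod_cast two_le_nearbyBound hn hT
  have hR : 1 ≤ thetaLen 3 (n' * T) T :=
    Nat.ceil_pos.2 (by linarith [one_le_logb_two hm])
  have hN : 2 ≤ 2 ^ B * thetaLen 3 (n' * T) T := by
    simpa using two_le_phi_outputs (n' := 1) le_rfl hB hR
  exact (hG _ _ _ hN (by omega) (by positivity)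
    (Real.rpow_le_one_of_one_le_of_nonpos (by linarith) (by norm_num))).1

theorem thetaGen_seedLen_le (hG : IsGeneratorFamily G C) (hT : 1 ≤ T) (hB : 1 ≤ B)
    (hn : 2 ≤ n' * T) : ((thetaGen G 3 8 n' T B).seedLen : ℝ) ≤
      17 * |C| * (Real.logb 2 B + Real.logb 2 (nearbyBound (n' * T) T)) := by
  have hm : (2 : ℝ) ≤ nearbyBound (n' * T) T := by exact_mod_cast two_le_nearbyBound hn hT
  have hlm := one_le_logb_two hm
  have hR : 1 ≤ thetaLen 3 (n' * T) T := Nat.ceil_pos.2 (by linarith)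
  have hRup : (thetaLen 3 (n' * T) T : ℝ) ≤ 3 * Real.logb 2 (nearbyBound (n' * T) T) + 1 :=
    (Nat.ceil_lt_add_one (by linarith)).le
  have hN : 2 ≤ 2 ^ B * thetaLen 3 (n' * T) T := by
    simpa using two_le_phi_outputs (n' := 1) le_rfl hB hR
  have hB' : (1 : ℝ) ≤ B := by exact_mod_cast hB
  have hlB : 0 ≤ Real.logb 2 B := Real.logb_nonneg one_lt_two hB'
  unfold thetaGen
  set m := nearbyBound (n' * T) T
  set R := thetaLen 3 (n' * T) T
  have hR' : (1 : ℝ) ≤ R := by exact_mod_cast hR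
  have hlmm := logb_two_le_self (y := (m : ℝ)) (by linarith)
  have hR4 : (R : ℝ) ≤ 4 * m := by linarith
  have hout : Real.logb 2 ((2 ^ B * R : ℕ) : ℝ) ≤ 5 * (B * m) := by
    push_cast
    rw [Real.logb_mul (by positivity) (by positivity), Real.logb_pow,
      Real.logb_self_eq_one one_lt_two]
    have h3 : Real.logb 2 R ≤ R := logb_two_le_self (by linarith)
    nlinarith
  have hseed := hG.seedLen_le (N := 2 ^ B * R) (κ := 2 * R) (η := (m : ℝ) ^ (-8 : ℝ))
    (Y := 40 * (B * (m : ℝ) ^ 10)) hN (by omega) (by positivity)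
    (Real.rpow_le_one_of_one_le_of_nonpos (by linarith) (by norm_num)) (by
      rw [Real.rpow_neg (by positivity), div_inv_eq_mul,
        show (8 : ℝ) = ((8 : ℕ) : ℝ) by norm_num, Real.rpow_natCast]
      have h1 : ((2 * R : ℕ) : ℝ) ≤ 8 * m := by push_cast; linarith
      have h0 : 0 ≤ Real.logb 2 ((2 ^ B * R : ℕ) : ℝ) :=
        zero_le_one.trans (one_le_logb_two (by exact_mod_cast hN))
      calc ((2 * R : ℕ) : ℝ) * Real.logb 2 ((2 ^ B * R : ℕ) : ℝ) * (m : ℝ) ^ 8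
          ≤ (8 * m) * (5 * (B * m)) * (m : ℝ) ^ 8 := by gcongr
        _ = _ := by ring)
  refine hseed.trans ?_
  rw [mul_comm 17 |C|, mul_assoc |C|]
  refine mul_le_mul_of_nonneg_left ?_ (abs_nonneg C)
  have h40 : Real.logb 2 40 ≤ 6 := by
    rw [Real.logb_le_iff_le_rpow one_lt_two (by norm_num)]
    norm_num
  rw [Real.logb_mul (by norm_num) (by positivity), Real.logb_mul (by positivity) (by positivity),
    Real.logb_pow]
  push_cast
  linarith

theorem exists_isLeastInjective_nearby (hG : IsGeneratorFamily G C) (hT : 1 ≤ T) (hB : 1 ≤ B)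
    (hn : 2 ≤ n' * T) (x : Fin (n' * T) → Bool) (t : Fin n') :
    ∃ v, IsLeastInjective (thetaGen G 3 8 n' T B) (nearby B x t) v :=
  exists_isLeastInjective (exists_injOn_thetaOf (thetaGen_isAlmostIndep hG hT hB hn) _ _
    (ncard_nearby_le B x t) (by positivity) (theta_union_bound (two_le_nearbyBound hn hT)))

end Construction

end SyncHash

theorem mainTheorem9 :
    (∃ C : ℝ, SyncHash.IsGeneratorFamily SyncHash.powerGenerator C) ∧
    ∃ (b e' : ℝ) (Dθ : ℝ → ℝ), 0 < b ∧ 0 < e' ∧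
    ∀ ε : ℝ, 0 < ε → ε < 1 →
    ∃ (a c e : ℝ) (Dφ : ℝ → ℝ), 0 < a ∧ 0 < c ∧ 0 < e ∧
    ∀ (G : (N : ℕ) → ℕ → ℝ → SyncHash.BitGenerator N) (C : ℝ),
      SyncHash.IsGeneratorFamily G C →
    ∀ (n' T B : ℕ) (x : Fin (n' * T) → Bool),
      B ≤ T → 2 ≤ n' * T → SyncHash.BDistinct B x →
      -- the seeds that describe the hash functions are short
      ((SyncHash.phiGen G a c e n' T B).seedLen : ℝ)
        ≤ Dφ C * Real.logb 2 ((n' * T : ℕ) : ℝ) ∧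
      ((SyncHash.thetaGen G b e' n' T B).seedLen : ℝ)
        ≤ Dθ C * (Real.logb 2 B + Real.logb 2 (SyncHash.nearbyBound (n' * T) T)) ∧
      -- both searches succeed
      (∃ u, SyncHash.PassesSearch ε (SyncHash.searchSize a c (n' * T) T) x
        (SyncHash.phiOf (SyncHash.phiGen G a c e n' T B) u)) ∧
      (∀ t : Fin n', ∃ v, SyncHash.IsLeastInjective (SyncHash.thetaGen G b e' n' T B)
        (SyncHash.nearby B x t) v) ∧
      -- whatever they return, the resulting sequence has the synchronization property
      ∀ (u : Fin (SyncHash.phiGen G a c e n' T B).seedLen → Bool)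
        (v : Fin n' → Fin (SyncHash.thetaGen G b e' n' T B).seedLen → Bool),
        SyncHash.PassesSearch ε (SyncHash.searchSize a c (n' * T) T) x
          (SyncHash.phiOf (SyncHash.phiGen G a c e n' T B) u) →
        (∀ t : Fin n', SyncHash.IsLeastInjective (SyncHash.thetaGen G b e' n' T B)
          (SyncHash.nearby B x t) (v t)) →
        SyncHash.LongIntervalProperty ε x
          (SyncHash.phiOf (SyncHash.phiGen G a c e n' T B) u) ∧
        (∀ t : Fin n', Set.InjOn (SyncHash.thetaOf (SyncHash.thetaGen G b e' n' T B) (v t))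
          (SyncHash.nearby B x t)) ∧
        SyncHash.IsSyncHash ε x
          (SyncHash.combine (SyncHash.phiOf (SyncHash.phiGen G a c e n' T B) u)
            (fun t => SyncHash.thetaOf (SyncHash.thetaGen G b e' n' T B) (v t))) := by
  refine ⟨⟨10, SyncHash.powerGenerator_isGeneratorFamily⟩, 3, 8, fun C => 17 * |C|,
    by norm_num, by norm_num, ?_⟩
  intro ε hε hε1
  have hlog : 0 ≤ Real.logb 2 (81 / ε ^ 2) := by
    refine Real.logb_nonneg one_lt_two ?_
    rw [le_div_iff₀ (by positivity)]
    nlinarith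
  have h80 : 0 < 4 * 20 / ε := by positivity
  -- `a ≥ 80 / ε` makes `ℓ` small, and `a ≥ 2 log (81 / ε²)` pays for the number of matchings
  obtain ⟨a, hadef⟩ : ∃ a, a = 4 * 20 / ε + 2 * Real.logb 2 (81 / ε ^ 2) + 2 := ⟨_, rfl⟩
  have ha2 : 2 ≤ a := by linarith
  have ha : 0 < a := by linarith
  obtain ⟨e, he⟩ : ∃ e, e = 10 + 2 * (20 + 2 * a + 1) := ⟨_, rfl⟩
  have he0 : 0 < e := by linarith
  refine ⟨a, 20, e, fun C => |C| * (3 + e + Real.logb 2 (2 * (20 + 2 * a + 1) * (2 * a + 3))),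
    ha, by norm_num, he0, ?_⟩
  intro G C hG n' T B x hBT hn hx
  have hT : 1 ≤ T := by
    rcases Nat.eq_zero_or_pos T with rfl | h
    · simp at hn
    · exact h
  have hn' : 1 ≤ n' := by
    rcases Nat.eq_zero_or_pos n' with rfl | h
    · simp at hn
    · exact h
  have hB : 1 ≤ B := hx.one_le (by omega)
  have hTn : T ≤ n' * T := Nat.le_mul_of_pos_left _ hn'
  refine ⟨SyncHash.phiGen_seedLen_le hG ha (by norm_num) he0 hn' hT hB hBT hn,
    SyncHash.thetaGen_seedLen_le hG hT hB hn, ?_,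
    fun t => SyncHash.exists_isLeastInjective_nearby hG hT hB hn x t, ?_⟩
  · exact SyncHash.exists_passesSearch hε (by positivity)
      (SyncHash.phiGen_isAlmostIndep hG ha (by norm_num) he0 hn' hT hB hn) rfl hT hBT hx
      (SyncHash.phi_union_bound hε ha2 (by linarith) he hn hT hTn)
  · intro u v hu hv
    have hlong := hu.longIntervalProperty hε hε1 hT
      (SyncHash.searchSize_pos ha (by norm_num) hn hT)
      (SyncHash.searchSize_eq_one_or_le hε (by norm_num) (by linarith) hn hT)
    have hθ := fun t => (hv t).1
    exact ⟨hlong, hθ, SyncHash.isSyncHash_combine hε hT hBT hx hlong hθ⟩
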